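/- Let $K$ be a connected compact Lie group acting continuously, by automorphisms $\sigma(k)$, $k\in K$, on an exponential solvable Lie group $S$ (a solvable Lie group whose exponential map $\exp:\mathfrak s\to S$ is a diffeomorphism), and let $G=K\ltimes S$ be the semidirect product, a connected Lie group for the product topology. Let $X_1,\dots,X_m$ be elements of the Lie algebra $\mathfrak g$ of $G$ which generate $\mathfrak g$ as a Lie algebra, and denote by $X_j^r$ the right-invariant vector field on $G$ with $X_j^r(g)=\frac{d}{dt}\big|_{t=0}\exp(tX_j)g$. Let $\delta$ be the associated Carnot–Carathéodory distance: $\delta(g,h)$ is the infimum of $\int_0^1\big(\sum_j a_j(t)^2\big)^{1/2}\,dt$ over all absolutely continuous curves $\gamma:[0,1]\to G$ with $\gamma(0)=g$, $\gamma(1)=h$ and all measurable $a_1,\dots,a_m:[0,1]\to\mathbb R$ such that $\gamma'(t)=\sum_j a_j(t)X_j^r(\gamma(t))$ for almost every $t$. For $d>0$ put $\omega_d(g)=e^{d\,\delta(g,e)}$, $g\in G$. Then there exists a constant $d>0$ such that $\frac1{\omega_d}\big|_S\in L^1(S)$, i.e. $1/\omega_d$ restricted to $S$ is integrable with respect to the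 left Haar measure of $S$. -/

import Mathlib

open scoped Manifold ContDiff ENNReal

section Basic

variable {E : Type*} [NormedAddCommGroup E] [NormedSpace ℝ E]
  {G : Type*} [TopologicalSpace G] [ChartedSpace E G] [Group G]

/-- A smooth real Lie group has the regularity that Mathlib asks for in order to make its tangent
space at the identity a Lie algebra. -/
instance instLieGroupMinSmoothnessOfInfty [LieGroup 𝓘(ℝ, E) ∞ G] :
    LieGroup 𝓘(ℝ, E) (minSmoothness ℝ 3) G :=
  LieGroup.of_le (n := ∞) (by simp only [minSmoothness_of_isRCLikeNormedField]; exact ENat.LEInfty.out)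

/-- `Φ` is the exponential map of the Lie group `G`: for each `X` in the Lie algebra,
`t ↦ Φ (t X)` is the integral curve, starting at the identity, of the left-invariant vector field
defined by `X`. The Lie algebra, i.e. the tangent space at the identity, is the model space `E`
as a topological vector space. -/
def IsLieExp (Φ : E → G) : Prop :=
  Φ 0 = 1 ∧ ∀ X : GroupLieAlgebra 𝓘(ℝ, E) G,
    IsMIntegralCurve (I := 𝓘(ℝ, E)) (fun t : ℝ => Φ (t • X)) (mulInvariantVectorField X)

variable (E G) in
/-- An exponential solvable Lie group: a solvable Lie group whose exponential map is a
diffeomorphism of the Lie algebra onto the group (so the group is connected and simply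
connected). -/
structure IsExponentialSolvable : Prop where
  solvable : Group.IsSolvable G
  exp_diffeo : ∃ Φ : Diffeomorph 𝓘(ℝ, E) 𝓘(ℝ, E) E G ∞, IsLieExp Φ

/-- The right-invariant vector field `X^r` on `G` with value `X` at the identity: its value at `g`
is the image of `X` under the differential of `h ↦ h * g`, i.e. the derivative at `t = 0` of
`(exp t X) * g`. -/
noncomputable def rightInvariantVectorField (X : GroupLieAlgebra 𝓘(ℝ, E) G) (g : G) :
    TangentSpace 𝓘(ℝ, E) g :=
  mfderiv 𝓘(ℝ, E) 𝓘(ℝ, E) (fun h : G => h * g) (1 : G) X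

/-- `X₁, …, X_m` is a Hörmander system: it generates the Lie algebra of `G` as a Lie algebra. -/
def IsHormanderSystem [FiniteDimensional ℝ E] [LieGroup 𝓘(ℝ, E) ∞ G] {m : ℕ}
    (X : Fin m → GroupLieAlgebra 𝓘(ℝ, E) G) : Prop :=
  haveI : CompleteSpace E := FiniteDimensional.complete ℝ E
  LieSubalgebra.lieSpan ℝ (GroupLieAlgebra 𝓘(ℝ, E) G) (Set.range X) = ⊤

/-- The restriction of `γ` to `[0, 1]` is a horizontal curve with controls `a₁, …, a_m`: it is
absolutely continuous (read in charts) and `γ' = ∑ j, a_j X_j^r(γ)` almost everywhere. -/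
structure IsHorizontalCurve {m : ℕ} (X : Fin m → GroupLieAlgebra 𝓘(ℝ, E) G)
    (γ : ℝ → G) (a : ℝ → EuclideanSpace ℝ (Fin m)) : Prop where
  continuousOn : ContinuousOn γ (Set.Icc 0 1)
  absolutelyContinuous : ∀ (x : G) (u v : ℝ), 0 ≤ u → u ≤ v → v ≤ 1 →
    (∀ t ∈ Set.Icc u v, γ t ∈ (chartAt E x).source) →
    AbsolutelyContinuousOnInterval (fun t => chartAt E x (γ t)) u v
  aestronglyMeasurable :
    MeasureTheory.AEStronglyMeasurable a (MeasureTheory.volume.restrict (Set.Icc (0 : ℝ) 1))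
  hasMFDerivAt : ∀ᵐ t ∂(MeasureTheory.volume.restrict (Set.Icc (0 : ℝ) 1)),
    HasMFDerivAt 𝓘(ℝ, ℝ) 𝓘(ℝ, E) γ t
      ((1 : ℝ →L[ℝ] ℝ).smulRight (∑ j, a t j • rightInvariantVectorField (X j) (γ t)))

/-- The Carnot–Carathéodory distance of `g` and `h` with values in `[0, ∞]`: the infimum of the
lengths `∫₀¹ (∑ j, a_j(t)²)^{1/2} dt` of the horizontal curves from `g` to `h`. -/
noncomputable def ccEDist {m : ℕ} (X : Fin m → GroupLieAlgebra 𝓘(ℝ, E) G) (g h : G) : ℝ≥0∞ :=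
  ⨅ (γ : ℝ → G) (a : ℝ → EuclideanSpace ℝ (Fin m)) (_ : IsHorizontalCurve X γ a)
    (_ : γ 0 = g) (_ : γ 1 = h), ∫⁻ t in Set.Icc (0 : ℝ) 1, ‖a t‖ₑ

/-- The Carnot–Carathéodory distance `δ` as a real number (on a connected group it is finite for a
Hörmander system). -/
noncomputable def ccDist {m : ℕ} (X : Fin m → GroupLieAlgebra 𝓘(ℝ, E) G) (g h : G) : ℝ :=
  (ccEDist X g h).toReal

/-- The weight `ω_d(g) = e^{d δ(g, e)}`. -/
noncomputable def ccWeight {m : ℕ} (X : Fin m → GroupLieAlgebra 𝓘(ℝ, E) G) (d : ℝ) (g : G) : ℝ :=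
  Real.exp (d * ccDist X g 1)

end Basic

/-- The product topology on a semidirect product of topological groups. -/
instance instTopologicalSpaceSemidirectProduct {S K : Type*} [Group S] [Group K]
    [TopologicalSpace S] [TopologicalSpace K] (σ : K →* MulAut S) :
    TopologicalSpace (S ⋊[σ] K) :=
  TopologicalSpace.induced (fun g : S ⋊[σ] K => (g.left, g.right)) inferInstance

/-! ### Exponential growth of powers of a compact neighbourhood -/

section Growth

open MeasureTheory Set Topology
open scoped Pointwise

/-! The traces on S of the δ-balls about e have at most exponentially growing Haar measure, and a
large enough d beats that growth.

Growth. Right translations preserve the fields X_j^r, so the right translates of a single bump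
function at e show that a piece of a horizontal curve of length less than some fixed r satisfies
γ(u)γ(v)⁻¹ ∈ U, where U is a prescribed neighbourhood of e (`exists_forall_mul_inv_mem`). Cutting a
curve of length less than nr into n such pieces gives {δ(·,e) < nr} ⊆ U^n
(`exists_ccEDist_lt_imp_mem_pow`). Take U = V × K with V a compact neighbourhood of 1 in S.
Compactness of K allows V to be K-invariant, so the S-components of U^n lie in V^n
(`SemidirectProduct.left_mem_pow`). Covering V·V by N left translates of V gives μ(V^(n+1)) ≤ N^n
μ(V) (`exists_measure_pow_le`), and a geometric series concludes (`exists_integrable_exp_neg_mul`).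

Regularity. It remains to know that δ(·,e) is finite and measurable. Both follow from a quantitative
Chow theorem (`displacementBall_mem_nhds_one`): left translation by an element near e increases the
distance to e by at most ε. For small ε, the span of the vectors Ad(h)X_j, with h of displacement at
most ε, no longer depends on ε; it is then stable under every ad X_i and hence all of 𝔤
(`adjointSpan_eq_top`). Products of curves h φ_j(t) h⁻¹, where φ_j is the flow line of X_j^r through
e, therefore fill a neighbourhood of e by the inverse function theorem. -/

/-- The powers of a compact neighbourhood of the identity have at most exponentially growing Haar
measure. -/
theorem exists_measure_pow_le {S : Type*} [Group S] [TopologicalSpace S] [IsTopologicalGroup S]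
    [MeasurableSpace S] [BorelSpace S] (μ : Measure S) [μ.IsMulLeftInvariant]
    {V : Set S} (hV : IsCompact V) (h1 : V ∈ 𝓝 (1 : S)) :
    ∃ N : ℕ, ∀ n : ℕ, μ (V ^ (n + 1)) ≤ (N : ℝ≥0∞) ^ n * μ V := by
  classical
  -- Only V·V has to be covered: the same finite set of centres serves at every power.
  obtain ⟨F, -, hF⟩ := (hV.mul hV).elim_nhds_subcover (fun x => x • V)
    (fun x _ => by simpa using smul_mem_nhds_smul x h1)
  have hcov : V * V ⊆ (F : Set S) * V := by
    intro y hy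
    obtain ⟨x, hx, hxy⟩ := mem_iUnion₂.1 (hF hy)
    obtain ⟨v, hv, rfl⟩ := hxy
    exact mul_mem_mul hx hv
  have hpow : ∀ n : ℕ, V ^ (n + 1) ⊆ (F : Set S) ^ n * V := by
    intro n
    induction n with
    | zero => simp
    | succ n ih =>
      calc V ^ (n + 1 + 1) = V ^ (n + 1) * V := pow_succ _ _
        _ ⊆ (F : Set S) ^ n * V * V := mul_subset_mul_right ih
        _ = (F : Set S) ^ n * (V * V) := mul_assoc _ _ _
        _ ⊆ (F : Set S) ^ n * ((F : Set S) * V) := mul_subset_mul_left hcov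
        _ = (F : Set S) ^ (n + 1) * V := by rw [← mul_assoc, pow_succ]
  refine ⟨F.card, fun n => ?_⟩
  calc μ (V ^ (n + 1)) ≤ μ ((F : Set S) ^ n * V) := measure_mono (hpow n)
    _ = μ (⋃ x ∈ F ^ n, x • V) := by
        congr 1
        rw [← Finset.coe_pow]
        ext y
        simp only [mem_mul, mem_smul_set, mem_iUnion, Finset.mem_coe, exists_prop, smul_eq_mul]
    _ ≤ ∑ x ∈ F ^ n, μ (x • V) := measure_biUnion_finset_le _ _
    _ = (F ^ n).card * μ V := by simp [measure_smul]
    _ ≤ (F.card : ℝ≥0∞) ^ n * μ V := by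
        gcongr
        exact_mod_cast Finset.card_pow_le

end Growth

/-! ### Absolute continuity under composition and gluing -/

section Interval

open MeasureTheory Set Topology AbsolutelyContinuousOnInterval
open scoped NNReal

namespace AbsolutelyContinuousOnInterval

variable {X : Type*} [PseudoMetricSpace X] {Y : Type*} [PseudoMetricSpace Y]

/-- Monotonicity keeps disjoint intervals disjoint, and the Lipschitz bound controls their total
length. This serves both the reparametrization t ↦ 2t - 1 and the truncations used for gluing. -/
theorem comp_monotone_lipschitz {f : ℝ → X} {φ : ℝ → ℝ} {a b c d : ℝ} {K : ℝ≥0}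
    (hf : AbsolutelyContinuousOnInterval f c d) (hφ : Monotone φ) (hK : LipschitzWith K φ)
    (hmaps : MapsTo φ (uIcc a b) (uIcc c d)) :
    AbsolutelyContinuousOnInterval (f ∘ φ) a b := by
  rw [absolutelyContinuousOnInterval_iff] at hf ⊢
  intro ε hε
  obtain ⟨δ, hδ, H⟩ := hf ε hε
  refine ⟨δ / (K + 1), by positivity, fun E hE hlt => ?_⟩
  refine H (E.1, fun i => (φ (E.2 i).1, φ (E.2 i).2)) ⟨fun i hi => ?_, ?_⟩ ?_
  · exact ⟨hmaps (hE.1 i hi).1, hmaps (hE.1 i hi).2⟩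
  · intro i hi j hj hij
    have := hE.2 hi hj hij
    simp only [Function.onFun, uIoc, Ioc_disjoint_Ioc] at this ⊢
    rw [← hφ.map_min, ← hφ.map_min, ← hφ.map_max, ← hφ.map_max, ← hφ.map_min, ← hφ.map_max]
    exact hφ this
  · calc _ ≤ ∑ i ∈ Finset.range E.1, (K : ℝ) * dist (E.2 i).1 (E.2 i).2 :=
          Finset.sum_le_sum fun i _ => hK.dist_le_mul _ _
      _ = K * ∑ i ∈ Finset.range E.1, dist (E.2 i).1 (E.2 i).2 := (Finset.mul_sum _ _ _).symm
      _ ≤ K * (δ / (K + 1)) := by gcongr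
      _ < (K + 1) * (δ / (K + 1)) := by gcongr; linarith
      _ = δ := by field

theorem lipschitzOnWith_comp {f : ℝ → X} {ψ : X → Y} {a b : ℝ} {K : ℝ≥0} {s : Set X}
    (hψ : LipschitzOnWith K ψ s) (hf : AbsolutelyContinuousOnInterval f a b)
    (hmaps : MapsTo f (uIcc a b) s) : AbsolutelyContinuousOnInterval (ψ ∘ f) a b := by
  rw [absolutelyContinuousOnInterval_iff] at hf ⊢
  intro ε hε
  obtain ⟨δ, hδ, H⟩ := hf (ε / (K + 1)) (by positivity)
  refine ⟨δ, hδ, fun E hE hlt => ?_⟩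
  calc _ ≤ ∑ i ∈ Finset.range E.1, (K : ℝ) * dist (f (E.2 i).1) (f (E.2 i).2) :=
        Finset.sum_le_sum fun i hi =>
          hψ.dist_le_mul _ (hmaps (hE.1 i hi).1) _ (hmaps (hE.1 i hi).2)
    _ = K * ∑ i ∈ Finset.range E.1, dist (f (E.2 i).1) (f (E.2 i).2) := (Finset.mul_sum _ _ _).symm
    _ ≤ K * (ε / (K + 1)) := by
        have := (H E hE hlt).le
        gcongr
    _ < (K + 1) * (ε / (K + 1)) := by gcongr; linarith
    _ = ε := by field

theorem congr {f g : ℝ → X} {a b : ℝ} (hf : AbsolutelyContinuousOnInterval f a b)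
    (h : EqOn f g (uIcc a b)) : AbsolutelyContinuousOnInterval g a b := by
  rw [absolutelyContinuousOnInterval_iff] at hf ⊢
  intro ε hε
  obtain ⟨δ, hδ, H⟩ := hf ε hε
  refine ⟨δ, hδ, fun E hE hlt => ?_⟩
  convert H E hE hlt using 3 with i hi
  · exact (h (hE.1 i hi).1).symm
  · exact (h (hE.1 i hi).2).symm

/-- On [u, v] one has f(t) = f(min t w) + f(max t w) - f(w), which avoids splitting families of
intervals at w. -/
theorem union {F : Type*} [SeminormedAddCommGroup F] {f : ℝ → F} {u w v : ℝ} (huw : u ≤ w)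
    (hwv : w ≤ v) (h₁ : AbsolutelyContinuousOnInterval f u w)
    (h₂ : AbsolutelyContinuousOnInterval f w v) : AbsolutelyContinuousOnInterval f u v := by
  have A : AbsolutelyContinuousOnInterval (f ∘ fun t => min t w) u v := by
    refine h₁.comp_monotone_lipschitz (K := 1) (fun x y h => min_le_min_right _ h) ?_ ?_
    · exact LipschitzWith.id.min_const w
    · intro t ht
      rw [uIcc_of_le (huw.trans hwv)] at ht
      rw [uIcc_of_le huw]
      exact ⟨le_min ht.1 huw, min_le_right _ _⟩
  have B : AbsolutelyContinuousOnInterval (f ∘ fun t => max t w) u v := by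
    refine h₂.comp_monotone_lipschitz (K := 1) (fun x y h => max_le_max_right _ h) ?_ ?_
    · exact LipschitzWith.id.max_const w
    · intro t ht
      rw [uIcc_of_le (huw.trans hwv)] at ht
      rw [uIcc_of_le hwv]
      exact ⟨le_max_right _ _, max_le ht.2 hwv⟩
  have C : AbsolutelyContinuousOnInterval (fun _ : ℝ => f w) u v :=
    (LipschitzWith.const (f w)).lipschitzOnWith.absolutelyContinuousOnInterval (K := 0)
  refine ((A.add B).sub C).congr fun t _ => ?_
  rcases le_total t w with h | h <;> simp [h]

end AbsolutelyContinuousOnInterval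

end Interval

/-! ### Mean value inequality from local absolute continuity -/

section FundamentalTheorem

open MeasureTheory Set Topology Filter

theorem AbsolutelyContinuousOnInterval.abs_sub_le {f g : ℝ → ℝ} {a b : ℝ} (hab : a ≤ b)
    (hf : AbsolutelyContinuousOnInterval f a b)
    (hfg : ∀ᵐ t, t ∈ Ioc a b → |deriv f t| ≤ g t) (hg : IntervalIntegrable g volume a b) :
    |f b - f a| ≤ ∫ t in a..b, g t := by
  rw [← hf.integral_deriv_eq_sub, ← Real.norm_eq_abs]
  exact intervalIntegral.norm_integral_le_of_norm_le hab hfg hg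

/-- A continuous function that is absolutely continuous on a small interval to the right of each
point satisfies the mean value inequality. -/
theorem abs_sub_le_integral_of_locally_absolutelyContinuous {f g : ℝ → ℝ} {a b : ℝ}
    (hab : a ≤ b) (hf : ContinuousOn f (Icc a b))
    (hloc : ∀ t ∈ Ico a b, ∀ᶠ τ in 𝓝[>] t, AbsolutelyContinuousOnInterval f t τ)
    (hfg : ∀ᵐ t, t ∈ Ioc a b → |deriv f t| ≤ g t) (hg : IntervalIntegrable g volume a b) :
    |f b - f a| ≤ ∫ t in a..b, g t := by
  have hgint : ContinuousOn (fun τ => ∫ t in a..τ, g t) (Icc a b) := by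
    have := intervalIntegral.continuousOn_primitive_interval' (a := a) hg left_mem_uIcc
    rwa [uIcc_of_le hab] at this
  set s : Set ℝ := {τ | |f τ - f a| ≤ ∫ t in a..τ, g t} with hs
  have hsub : Icc a b ⊆ s := by
    -- Continuous induction: the set of τ satisfying the inequality is closed in [a, b], and from
    -- each of its points below b it extends a little to the right.
    refine IsClosed.Icc_subset_of_forall_mem_nhdsWithin ?_ (by simp [hs]) ?_
    · rw [inter_comm]
      exact isClosed_Icc.isClosed_le (hf.sub continuousOn_const).abs hgint
    · rintro t ⟨hts, hta, htb⟩
      filter_upwards [hloc t ⟨hta, htb⟩, Ioo_mem_nhdsGT htb] with τ hτ hτb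
      have h1 : IntervalIntegrable g volume a t :=
        hg.mono_set (by rw [uIcc_of_le hta, uIcc_of_le hab]; exact Icc_subset_Icc_right htb.le)
      have h2 : IntervalIntegrable g volume t τ :=
        hg.mono_set (by
          rw [uIcc_of_le hτb.1.le, uIcc_of_le hab]; exact Icc_subset_Icc hta hτb.2.le)
      have h3 := hτ.abs_sub_le hτb.1.le (g := g)
        (hfg.mono fun x hx hx' => hx ⟨hta.trans_lt hx'.1, hx'.2.trans hτb.2.le⟩) h2
      have h4 : |f t - f a| ≤ ∫ t in a..t, g t := hts
      change |f τ - f a| ≤ ∫ t in a..τ, g t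
      rw [← intervalIntegral.integral_add_adjacent_intervals h1 h2]
      calc |f τ - f a| ≤ |f τ - f t| + |f t - f a| := abs_sub_le _ _ _
        _ ≤ _ := by linarith
  exact hsub (right_mem_Icc.2 hab)

end FundamentalTheorem

/-! ### Right-invariant fields and functions along horizontal curves -/

section Horizontal

open MeasureTheory Set Topology Filter

variable {E : Type*} [NormedAddCommGroup E] [NormedSpace ℝ E]
  {G : Type*} [TopologicalSpace G] [ChartedSpace E G] [Group G] [LieGroup 𝓘(ℝ, E) ∞ G]

variable (E) in
theorem mdifferentiableAt_mul_const (g h : G) :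
    MDifferentiableAt 𝓘(ℝ, E) 𝓘(ℝ, E) (fun x : G => x * g) h :=
  (contMDiff_mul_right (I := 𝓘(ℝ, E)) (n := ∞) (a := g)).mdifferentiableAt (by simp)

/-- Differentiate x(gk) = (xg)k at x = 1. This invariance makes the later estimates uniform over the
group. -/
theorem rightInvariantVectorField_mul (X : GroupLieAlgebra 𝓘(ℝ, E) G) (g k : G) :
    rightInvariantVectorField X (g * k) =
      mfderiv 𝓘(ℝ, E) 𝓘(ℝ, E) (fun x : G => x * k) g (rightInvariantVectorField X g) := by
  have h : (fun x : G => x * (g * k)) = (fun x : G => x * k) ∘ fun x : G => x * g := by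
    ext x; simp [mul_assoc]
  have h2 := mfderiv_comp (I := 𝓘(ℝ, E)) (I' := 𝓘(ℝ, E)) (I'' := 𝓘(ℝ, E)) (1 : G)
    (mdifferentiableAt_mul_const E k (1 * g)) (mdifferentiableAt_mul_const E g 1)
  rw [← h] at h2
  exact (DFunLike.congr_fun h2 X).trans (congrArg (fun p : G =>
    (mfderiv 𝓘(ℝ, E) 𝓘(ℝ, E) (fun x : G => x * k) p : E →L[ℝ] E)
      (mfderiv 𝓘(ℝ, E) 𝓘(ℝ, E) (fun x : G => x * g) (1 : G) X : E)) (one_mul g))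

/-- The value at g is the differential of multiplication at (1, g) applied to (X, 0), so the field
is a tangent map composed with smooth sections. -/
theorem contMDiff_rightInvariantVectorField (X : GroupLieAlgebra 𝓘(ℝ, E) G) :
    ContMDiff 𝓘(ℝ, E) (𝓘(ℝ, E).tangent) 1
      (fun g : G => (⟨g, rightInvariantVectorField X g⟩ : TangentBundle 𝓘(ℝ, E) G)) := by
  have : LieGroup 𝓘(ℝ, E) 2 G := LieGroup.of_le (n := ∞) ENat.LEInfty.out
  let fg : G → TangentBundle 𝓘(ℝ, E) G := fun g => ⟨g, 0⟩
  have sfg : ContMDiff 𝓘(ℝ, E) (𝓘(ℝ, E).tangent) 1 fg := Bundle.contMDiff_zeroSection _ _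
  let fv : G → TangentBundle 𝓘(ℝ, E) G := fun _ => ⟨1, X⟩
  have sfv : ContMDiff 𝓘(ℝ, E) (𝓘(ℝ, E).tangent) 1 fv := contMDiff_const
  let F₁ : G → (TangentBundle 𝓘(ℝ, E) G × TangentBundle 𝓘(ℝ, E) G) := fun g => (fv g, fg g)
  have S₁ : ContMDiff 𝓘(ℝ, E) (𝓘(ℝ, E).tangent.prod 𝓘(ℝ, E).tangent) 1 F₁ := sfv.prodMk sfg
  let F₂ : (TangentBundle 𝓘(ℝ, E) G × TangentBundle 𝓘(ℝ, E) G) →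
      TangentBundle (𝓘(ℝ, E).prod 𝓘(ℝ, E)) (G × G) :=
    (equivTangentBundleProd 𝓘(ℝ, E) G 𝓘(ℝ, E) G).symm
  have S₂ : ContMDiff (𝓘(ℝ, E).tangent.prod 𝓘(ℝ, E).tangent)
      (𝓘(ℝ, E).prod 𝓘(ℝ, E)).tangent 1 F₂ := contMDiff_equivTangentBundleProd_symm
  let F₃ : TangentBundle (𝓘(ℝ, E).prod 𝓘(ℝ, E)) (G × G) → TangentBundle 𝓘(ℝ, E) G :=
    tangentMap (𝓘(ℝ, E).prod 𝓘(ℝ, E)) 𝓘(ℝ, E) (fun p : G × G => p.1 * p.2)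
  have S₃ : ContMDiff (𝓘(ℝ, E).prod 𝓘(ℝ, E)).tangent 𝓘(ℝ, E).tangent 1 F₃ := by
    apply ContMDiff.contMDiff_tangentMap (n := 2) _ (m := 1) (by norm_num)
    exact contMDiff_mul 𝓘(ℝ, E) 2
  have S := (S₃.comp S₂).comp S₁
  convert! S with g
  · simp [F₁, F₂, F₃, fg, fv]
  · simp only [Function.comp_apply, tangentMap, F₃, F₂, F₁, fg, fv]
    rw [mfderiv_prod_eq_add_apply ((contMDiff_mul 𝓘(ℝ, E) 2).mdifferentiableAt (by simp))]
    simp +instances only [rightInvariantVectorField]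
    exact ((congrArg (fun x : E => (show E from mfderiv 𝓘(ℝ, E) 𝓘(ℝ, E) (fun h : G => h * g) 1 X) + x)
      (ContinuousLinearMap.map_zero _)).trans (add_zero _)).symm

omit [Group G] [LieGroup 𝓘(ℝ, E) ∞ G] in
theorem HasMFDerivAt.hasDerivAt_comp {E' : Type*} [NormedAddCommGroup E'] [NormedSpace ℝ E']
    {γ : ℝ → G} {F : G → E'} {t : ℝ} {v : E}
    (hγ : HasMFDerivAt 𝓘(ℝ, ℝ) 𝓘(ℝ, E) γ t ((1 : ℝ →L[ℝ] ℝ).smulRight v))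
    (hF : MDifferentiableAt 𝓘(ℝ, E) 𝓘(ℝ, E') F (γ t)) :
    HasDerivAt (F ∘ γ) ((mfderiv 𝓘(ℝ, E) 𝓘(ℝ, E') F (γ t) : E →L[ℝ] E') v) t := by
  have h3 : ∀ (L : E →L[ℝ] E') (v : E), L.comp ((1 : ℝ →L[ℝ] ℝ).smulRight v) =
      (1 : ℝ →L[ℝ] ℝ).smulRight (L v) := fun L v => by ext; simp
  have h := (hF.hasMFDerivAt.comp t hγ).hasFDerivAt
  have h4 : HasFDerivAt (F ∘ γ) ((1 : ℝ →L[ℝ] ℝ).smulRight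
      ((mfderiv 𝓘(ℝ, E) 𝓘(ℝ, E') F (γ t) : E →L[ℝ] E') v)) t := h3 _ v ▸ h
  have h5 : ∀ w : E', HasFDerivAt (F ∘ γ) ((1 : ℝ →L[ℝ] ℝ).smulRight w) t →
      HasDerivAt (F ∘ γ) w t := fun w hw => by simpa using hw.hasDerivAt
  exact h5 _ h4

/-- The integral curve of a right-invariant vector field through the identity, for small times. -/
theorem exists_integralCurve_rightInvariantVectorField [CompleteSpace E]
    (X : GroupLieAlgebra 𝓘(ℝ, E) G) :
    ∃ φ : ℝ → G, φ 0 = 1 ∧ ∃ η > 0, (∀ t ∈ Ioo (-η) η,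
      HasMFDerivAt 𝓘(ℝ, ℝ) 𝓘(ℝ, E) φ t
        ((1 : ℝ →L[ℝ] ℝ).smulRight (rightInvariantVectorField X (φ t)))) ∧
      ContMDiffOn 𝓘(ℝ, ℝ) 𝓘(ℝ, E) 1 φ (Ioo (-η) η) := by
  have : IsManifold 𝓘(ℝ, E) 1 G := IsManifold.of_le (n := ∞) ENat.LEInfty.out
  have hX := contMDiff_rightInvariantVectorField X
  obtain ⟨φ, h0, hφ⟩ := exists_isMIntegralCurveAt_of_contMDiffAt_boundaryless (0 : ℝ)
    hX.contMDiffAt (x₀ := (1 : G))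
  have hw := (Bundle.contMDiffAt_totalSpace.1 (hX.contMDiffAt (x := φ 0))).2
  -- On W the field is C¹ in the trivialization. Being the velocity of φ in the chart, it upgrades φ
  -- from differentiable to C¹.
  obtain ⟨W, hW, hwW⟩ := (contMDiffAt_iff_contMDiffOn_nhds (by simp)).1 hw
  have hev : ∀ᶠ t in 𝓝 (0 : ℝ), φ t ∈ interior W ∩ (chartAt E (φ 0)).source :=
    hφ.continuousAt.eventually_mem (Filter.inter_mem (interior_mem_nhds.2 hW)
      ((chartAt E (φ 0)).open_source.mem_nhds (mem_chart_source E _)))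
  obtain ⟨η, hη, H⟩ := Metric.eventually_nhds_iff.1
    (hφ.and (hev.and hφ.eventually_hasDerivAt))
  replace H : ∀ t ∈ Ioo (-η) η, _ := fun t ht => H (by simpa [abs_lt] using ht)
  refine ⟨φ, h0, η, hη, fun t ht => (H t ht).1, ?_⟩
  have hcont : ContinuousOn φ (Ioo (-η) η) := fun t ht =>
    ((H t ht).1.continuousAt).continuousWithinAt
  have hd : ContDiffOn ℝ 1 (extChartAt 𝓘(ℝ, E) (φ 0) ∘ φ) (Ioo (-η) η) := by
    have hderiv : ∀ t ∈ Ioo (-η) η, HasDerivAt (extChartAt 𝓘(ℝ, E) (φ 0) ∘ φ)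
        (trivializationAt E (TangentSpace 𝓘(ℝ, E)) (φ 0)
          ⟨φ t, rightInvariantVectorField X (φ t)⟩).2 t := fun t ht => by
      rw [TangentBundle.trivializationAt_apply]
      exact (H t ht).2.2
    rw [contDiffOn_one_iff_derivWithin isOpen_Ioo.uniqueDiffOn]
    refine ⟨fun t ht => (hderiv t ht).differentiableAt.differentiableWithinAt, ?_⟩
    refine (hwW.continuousOn.comp hcont
      (fun t ht => interior_subset (H t ht).2.1.1)).congr fun t ht => ?_
    rw [derivWithin_of_isOpen isOpen_Ioo ht, (hderiv t ht).deriv]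
    rfl
  have hs := (contMDiffOn_extChartAt_symm (I := 𝓘(ℝ, E)) (n := 1) (φ 0)).comp hd.contMDiffOn
    (fun t ht => (extChartAt 𝓘(ℝ, E) (φ 0)).map_source
      (by rw [extChartAt_source]; exact (H t ht).2.1.2))
  refine hs.congr fun t ht => ?_
  simp only [Function.comp_apply]
  rw [(extChartAt 𝓘(ℝ, E) (φ 0)).left_inv (by rw [extChartAt_source]; exact (H t ht).2.1.2)]

/-- Right translates of curves tangent to a right-invariant vector field. -/
theorem HasMFDerivAt.mul_const_rightInvariant {γ : ℝ → G} {t : ℝ} {c : ℝ}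
    {X : GroupLieAlgebra 𝓘(ℝ, E) G}
    (h : HasMFDerivAt 𝓘(ℝ, ℝ) 𝓘(ℝ, E) γ t
      ((1 : ℝ →L[ℝ] ℝ).smulRight (c • rightInvariantVectorField X (γ t)))) (k : G) :
    HasMFDerivAt 𝓘(ℝ, ℝ) 𝓘(ℝ, E) (fun s => γ s * k) t
      ((1 : ℝ →L[ℝ] ℝ).smulRight (c • rightInvariantVectorField X (γ t * k))) := by
  have h2 := (mdifferentiableAt_mul_const E k (γ t)).hasMFDerivAt.comp t h
  have h3 : ∀ (L : E →L[ℝ] E) (v : E), (1 : ℝ →L[ℝ] ℝ).smulRight (c • L v) =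
      L.comp ((1 : ℝ →L[ℝ] ℝ).smulRight (c • v)) := fun L v => by ext; simp
  rw [rightInvariantVectorField_mul]
  exact (h3 _ _) ▸ h2

/-- The derivative of the function `F` along the right-invariant vector field `X^r`. -/
noncomputable def rightDerivative (X : GroupLieAlgebra 𝓘(ℝ, E) G) (F : G → ℝ) (g : G) : ℝ :=
  (mfderiv 𝓘(ℝ, E) 𝓘(ℝ, ℝ) F g : E →L[ℝ] ℝ) (rightInvariantVectorField X g : E)

section Estimate

variable {m : ℕ} {X : Fin m → GroupLieAlgebra 𝓘(ℝ, E) G} {γ : ℝ → G}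
  {a : ℝ → EuclideanSpace ℝ (Fin m)}

/-- By the chain rule (F ∘ γ)' = ∑ a_j X_j^r F almost everywhere, and |a_j| ≤ ‖a‖. Since γ is
absolutely continuous only in charts, the local form of the mean value inequality is needed. -/
theorem IsHorizontalCurve.abs_sub_le_integral (hγ : IsHorizontalCurve X γ a)
    (ha : IntegrableOn a (Icc 0 1)) {F : G → ℝ} (hF : ContMDiff 𝓘(ℝ, E) 𝓘(ℝ, ℝ) 1 F) {C : ℝ}
    (hC : ∀ j g, |rightDerivative (X j) F g| ≤ C)
    {u v : ℝ} (hu : 0 ≤ u) (huv : u ≤ v) (hv : v ≤ 1) :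
    |F (γ v) - F (γ u)| ≤ m * C * ∫ t in u..v, ‖a t‖ := by
  have hman : IsManifold 𝓘(ℝ, E) 1 G := IsManifold.of_le (n := ∞) ENat.LEInfty.out
  have hsub : Icc u v ⊆ Icc 0 1 := Icc_subset_Icc hu hv
  have hint : IntervalIntegrable (fun t => ‖a t‖) volume u v := by
    rw [intervalIntegrable_iff_integrableOn_Icc_of_le huv]
    exact (ha.mono_set hsub).norm
  rw [← intervalIntegral.integral_const_mul]
  refine abs_sub_le_integral_of_locally_absolutelyContinuous (f := F ∘ γ) huv
    (hF.continuous.comp_continuousOn (hγ.continuousOn.mono hsub)) ?_ ?_ (hint.const_mul _)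
  · rintro t ⟨hut, htv⟩
    have ht01 : t ∈ Icc (0 : ℝ) 1 := ⟨hu.trans hut, htv.le.trans hv⟩
    set e := chartAt E (γ t) with he
    have hsrc : γ t ∈ e.source := mem_chart_source E (γ t)
    -- In the chart F is C¹, hence Lipschitz near γ(t), so it preserves absolute continuity on a
    -- short interval to the right of t.
    have hψ : ContDiffAt ℝ 1 (F ∘ e.symm) (e (γ t)) := by
      rw [← contMDiffAt_iff_contDiffAt]
      refine hF.contMDiffAt.comp _ ?_
      exact (contMDiffOn_chart_symm (I := 𝓘(ℝ, E)) (x := γ t)).contMDiffAt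
        (e.open_target.mem_nhds (e.map_source hsrc))
    obtain ⟨K, s, hs, hK⟩ := hψ.exists_lipschitzOnWith
    have hev : ∀ᶠ τ in 𝓝[Icc 0 1] t, γ τ ∈ e.source ∧ e (γ τ) ∈ s := by
      have h1 := hγ.continuousOn t ht01
      exact (h1.eventually_mem (e.open_source.mem_nhds hsrc)).and
        (((e.continuousAt hsrc).comp_continuousWithinAt h1).eventually_mem hs)
    have hev' : ∀ᶠ τ in 𝓝[≥] t, γ τ ∈ e.source ∧ e (γ τ) ∈ s := by
      rw [← nhdsWithin_Icc_eq_nhdsGE (htv.trans_le hv)]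
      exact hev.filter_mono (nhdsWithin_mono _ (Icc_subset_Icc_left ht01.1))
    obtain ⟨b, hb, hbs⟩ := (mem_nhdsGE_iff_exists_Icc_subset).1 hev'
    filter_upwards [Ioo_mem_nhdsGT hb, Ioo_mem_nhdsGT htv] with τ hτ hτv
    have hmem : ∀ x ∈ Icc t τ, γ x ∈ e.source ∧ e (γ x) ∈ s := fun x hx =>
      hbs ⟨hx.1, hx.2.trans hτ.2.le⟩
    have hac := hγ.absolutelyContinuous (γ t) t τ ht01.1 hτ.1.le (hτv.2.le.trans hv)
      fun x hx => (hmem x hx).1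
    refine (hac.lipschitzOnWith_comp hK ?_).congr ?_
    · rw [uIcc_of_le hτ.1.le]
      exact fun x hx => (hmem x hx).2
    · rw [uIcc_of_le hτ.1.le]
      intro x hx
      simp only [Function.comp_apply]
      rw [e.left_inv (hmem x hx).1]
  · have := (ae_restrict_iff' measurableSet_Icc).1 hγ.hasMFDerivAt
    filter_upwards [this] with t ht htI
    have h1 := ht (hsub ⟨htI.1.le, htI.2⟩)
    have h2 := h1.hasDerivAt_comp (hF.mdifferentiableAt (by simp))
    have h3 : deriv (F ∘ γ) t = ∑ j, a t j * rightDerivative (X j) F (γ t) := by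
      rw [h2.deriv]
      have : ∀ (L : E →L[ℝ] ℝ) (w : Fin m → E), L (∑ j, a t j • w j) = ∑ j, a t j * L (w j) :=
        fun L w => by simp
      exact this _ _
    rw [h3]
    calc _ ≤ ∑ j, |a t j * rightDerivative (X j) F (γ t)| := Finset.abs_sum_le_sum_abs _ _
      _ ≤ ∑ _j : Fin m, C * ‖a t‖ := by
          refine Finset.sum_le_sum fun j _ => ?_
          rw [abs_mul, mul_comm]
          exact mul_le_mul (hC j _) (PiLp.norm_apply_le (a t) j) (abs_nonneg _)
            ((abs_nonneg _).trans (hC j 1))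
      _ = m * C * ‖a t‖ := by simp [mul_assoc]

end Estimate

end Horizontal

/-! ### Cutting horizontal curves into short pieces -/

section Splitting

open MeasureTheory Set Topology Filter
open scoped Pointwise

/-- The product telescopes. The intermediate value theorem chooses v so that the first piece carries
exactly 1/(n+1) of the remaining length. -/
theorem mul_inv_mem_pow_of_forall_short {G : Type*} [Group G] {m : ℕ} {U : Set G} {r : ℝ} {γ : ℝ → G}
    {a : ℝ → EuclideanSpace ℝ (Fin m)} (ha : IntegrableOn a (Icc 0 1))
    (hr : ∀ u v, 0 ≤ u → u ≤ v → v ≤ 1 → ∫ t in u..v, ‖a t‖ < r → γ u * (γ v)⁻¹ ∈ U)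
    (n : ℕ) (u : ℝ) (hu : 0 ≤ u) (hu1 : u ≤ 1) (h : ∫ t in u..1, ‖a t‖ < n * r) :
    γ u * (γ 1)⁻¹ ∈ U ^ n := by
  induction n generalizing u with
  | zero =>
    have := intervalIntegral.integral_nonneg (μ := volume) hu1 (f := fun t => ‖a t‖) (fun _ _ => norm_nonneg _)
    simp at h
    linarith
  | succ n ih =>
    set T := ∫ t in u..1, ‖a t‖ with hT
    have hT0 : 0 ≤ T := intervalIntegral.integral_nonneg hu1 (fun _ _ => norm_nonneg _)
    have hint : ∀ x y, 0 ≤ x → x ≤ y → y ≤ 1 →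
        IntervalIntegrable (fun t => ‖a t‖) volume x y := fun x y hx hxy hy => by
      rw [intervalIntegrable_iff_integrableOn_Icc_of_le hxy]
      exact (ha.mono_set (Icc_subset_Icc hx hy)).norm
    have hcont : ContinuousOn (fun τ => ∫ t in u..τ, ‖a t‖) (Icc u 1) := by
      have := intervalIntegral.continuousOn_primitive_interval' (a := u)
        (hint u 1 hu hu1 le_rfl) left_mem_uIcc
      rwa [uIcc_of_le hu1] at this
    have hn : (0 : ℝ) < n + 1 := by positivity
    push_cast at h
    have hq : T / (n + 1) < r := by rw [div_lt_iff₀ hn]; linarith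
    obtain ⟨v, ⟨huv, hv1⟩, hv⟩ := intermediate_value_Icc hu1 hcont
      (show T / (n + 1) ∈ _ by
        simp only [intervalIntegral.integral_same]
        exact ⟨by positivity, div_le_self hT0 (by linarith [(Nat.cast_nonneg n : (0:ℝ) ≤ n)])⟩)
    have hadd := intervalIntegral.integral_add_adjacent_intervals (hint u v hu huv hv1)
      (hint v 1 (hu.trans huv) hv1 le_rfl)
    rw [← hT, show ∫ t in u..v, ‖a t‖ = T / (n + 1) from hv] at hadd
    rw [pow_succ']
    have hsplit : γ u * (γ 1)⁻¹ = (γ u * (γ v)⁻¹) * (γ v * (γ 1)⁻¹) := by group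
    rw [hsplit]
    have hTn : T / (n + 1) * (n + 1) = T := by field
    -- For n = 0 the induction hypothesis cannot be applied: the remainder has length 0, which is
    -- not less than 0 · r.
    rcases Nat.eq_zero_or_pos n with rfl | hn0
    · simp only [Nat.cast_zero, zero_add, div_one, pow_zero, mul_one] at *
      rw [← hsplit]
      exact hr u 1 hu hu1 le_rfl (by linarith)
    · refine mul_mem_mul (hr u v hu huv hv1 (hv.trans_lt hq)) (ih v (hu.trans huv) hv1 ?_)
      have : (0 : ℝ) < n := by exact_mod_cast hn0
      nlinarith

variable {E : Type*} [NormedAddCommGroup E] [NormedSpace ℝ E]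
  {G : Type*} [TopologicalSpace G] [ChartedSpace E G] [Group G] [LieGroup 𝓘(ℝ, E) ∞ G]

theorem continuous_rightDerivative (X : GroupLieAlgebra 𝓘(ℝ, E) G) {F : G → ℝ}
    (hF : ContMDiff 𝓘(ℝ, E) 𝓘(ℝ, ℝ) 1 F) : Continuous (rightDerivative X F) := by
  have : IsManifold 𝓘(ℝ, E) 1 G := IsManifold.of_le (n := ∞) ENat.LEInfty.out
  have h1 := (hF.continuous_tangentMap (by simp)).comp
    (contMDiff_rightInvariantVectorField X).continuous
  have h2 := (tangentBundleModelSpaceHomeomorph 𝓘(ℝ, ℝ)).continuous.comp h1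
  exact continuous_snd.comp h2

omit [LieGroup 𝓘(ℝ, E) ∞ G] in
theorem rightDerivative_eq_zero_of_notMem_tsupport (X : GroupLieAlgebra 𝓘(ℝ, E) G) {F : G → ℝ}
    {g : G} (hg : g ∉ tsupport F) : rightDerivative X F g = 0 := by
  have h : F =ᶠ[𝓝 g] fun _ => 0 := by
    filter_upwards [(isClosed_tsupport F).isOpen_compl.mem_nhds hg] with x hx
    exact image_eq_zero_of_notMem_tsupport hx
  have h2 := h.mfderiv_eq (I := 𝓘(ℝ, E)) (I' := 𝓘(ℝ, ℝ))
  rw [mfderiv_const] at h2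
  exact (DFunLike.congr_fun h2 _).trans rfl

theorem exists_abs_rightDerivative_le [T2Space G] {m : ℕ} (X : Fin m → GroupLieAlgebra 𝓘(ℝ, E) G) {F : G → ℝ}
    (hF : ContMDiff 𝓘(ℝ, E) 𝓘(ℝ, ℝ) 1 F) (hs : HasCompactSupport F) :
    ∃ C, 0 ≤ C ∧ ∀ j g, |rightDerivative (X j) F g| ≤ C := by
  have : ∀ j, ∃ C, ∀ g, ‖rightDerivative (X j) F g‖ ≤ C := fun j =>
    (continuous_rightDerivative (X j) hF).bounded_above_of_compact_support
      (HasCompactSupport.intro hs fun g hg => rightDerivative_eq_zero_of_notMem_tsupport _ hg)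
  choose C hC using this
  refine ⟨∑ j, |C j|, by positivity, fun j g => (hC j g).trans ((le_abs_self _).trans ?_)⟩
  exact Finset.single_le_sum (f := fun j => |C j|) (fun _ _ => abs_nonneg _) (Finset.mem_univ j)

theorem rightDerivative_mul_const (X : GroupLieAlgebra 𝓘(ℝ, E) G) {F : G → ℝ}
    (hF : ContMDiff 𝓘(ℝ, E) 𝓘(ℝ, ℝ) 1 F) (k g : G) :
    rightDerivative X (fun x => F (x * k)) g = rightDerivative X F (g * k) := by
  have h := mfderiv_comp (I := 𝓘(ℝ, E)) (I' := 𝓘(ℝ, E)) (I'' := 𝓘(ℝ, ℝ)) (f := fun x => x * k) g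
    (hF.mdifferentiableAt (by simp)) (mdifferentiableAt_mul_const E k g)
  unfold rightDerivative
  rw [rightInvariantVectorField_mul]
  exact DFunLike.congr_fun h _

variable {m : ℕ} {X : Fin m → GroupLieAlgebra 𝓘(ℝ, E) G}

/-- Short horizontal curves stay close to their end point, uniformly on the group. -/
theorem exists_forall_mul_inv_mem [FiniteDimensional ℝ E] [T2Space G]
    (X : Fin m → GroupLieAlgebra 𝓘(ℝ, E) G) {U : Set G} (hU : U ∈ 𝓝 (1 : G)) :
    ∃ r > 0, ∀ (γ : ℝ → G) (a : ℝ → EuclideanSpace ℝ (Fin m)), IsHorizontalCurve X γ a →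
      IntegrableOn a (Icc 0 1) → ∀ u v, 0 ≤ u → u ≤ v → v ≤ 1 → ∫ t in u..v, ‖a t‖ < r →
        γ u * (γ v)⁻¹ ∈ U := by
  obtain ⟨f, -, hf⟩ := (SmoothBumpFunction.nhds_basis_tsupport (I := 𝓘(ℝ, E)) (1 : G)).mem_iff.1 hU
  have hF : ContMDiff 𝓘(ℝ, E) 𝓘(ℝ, ℝ) 1 f := f.contMDiff.of_le ENat.LEInfty.out
  obtain ⟨C, hC0, hC⟩ := exists_abs_rightDerivative_le X hF f.hasCompactSupport
  -- With this r the bump function varies by less than 1 along the piece; the summand 1 covers m C =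
  -- 0.
  refine ⟨1 / (m * C + 1), by positivity, fun γ a hγ ha u v hu huv hv hlt => ?_⟩
  -- The translated bump equals 1 at γ(v) and obeys the same bound C by right invariance, so it
  -- cannot vanish at γ(u).
  have h := hγ.abs_sub_le_integral ha (F := fun x => f (x * (γ v)⁻¹))
    (hF.comp (contMDiff_mul_right.of_le ENat.LEInfty.out)) (C := C)
    (fun j g => by rw [rightDerivative_mul_const _ hF]; exact hC _ _) hu huv hv
  have h2 : m * C * ∫ t in u..v, ‖a t‖ < 1 := by
    calc m * C * ∫ t in u..v, ‖a t‖ ≤ m * C * (1 / (m * C + 1)) := by gcongr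
      _ < (m * C + 1) * (1 / (m * C + 1)) := by gcongr; linarith
      _ = 1 := by field
  simp only [mul_inv_cancel, f.eq_one] at h
  refine hf (subset_tsupport _ fun h0 => ?_)
  rw [h0] at h
  norm_num at h
  linarith

/-- A point at Carnot–Carathéodory distance less than `n r` from the identity is a product of `n`
elements of `U`. -/
theorem exists_ccEDist_lt_imp_mem_pow [FiniteDimensional ℝ E] [T2Space G]
    (X : Fin m → GroupLieAlgebra 𝓘(ℝ, E) G) {U : Set G} (hU : U ∈ 𝓝 (1 : G)) :
    ∃ r > 0, ∀ (n : ℕ) (g : G), ccEDist X g 1 < ENNReal.ofReal (n * r) → g ∈ U ^ n := by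
  obtain ⟨r, hr, H⟩ := exists_forall_mul_inv_mem X hU
  refine ⟨r, hr, fun n g hg => ?_⟩
  simp only [ccEDist, iInf_lt_iff] at hg
  obtain ⟨γ, a, hγ, rfl, h1, hlt⟩ := hg
  have ha : IntegrableOn a (Icc 0 1) :=
    ⟨hγ.aestronglyMeasurable, hlt.trans ENNReal.ofReal_lt_top⟩
  have := mul_inv_mem_pow_of_forall_short ha (H γ a hγ ha) n 0 le_rfl zero_le_one ?_
  · simpa [h1] using this
  · rw [intervalIntegral.integral_of_le zero_le_one, ← integral_Icc_eq_integral_Ioc,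
      integral_norm_eq_lintegral_enorm hγ.aestronglyMeasurable]
    exact (ENNReal.lt_ofReal_iff_toReal_lt hlt.ne_top).1 hlt

end Splitting

/-! ### Prolonging horizontal curves by flow lines -/

section Concatenation

open MeasureTheory Set Topology Filter

variable {E : Type*} [NormedAddCommGroup E] [NormedSpace ℝ E]
  {G : Type*} [TopologicalSpace G] [ChartedSpace E G]

theorem HasMFDerivAt.congr_velocity {γ γ' : ℝ → G} {t : ℝ} {v v' : E}
    (h : HasMFDerivAt 𝓘(ℝ, ℝ) 𝓘(ℝ, E) γ t ((1 : ℝ →L[ℝ] ℝ).smulRight v)) (hγ : γ' =ᶠ[𝓝 t] γ)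
    (hv : v' = v) : HasMFDerivAt 𝓘(ℝ, ℝ) 𝓘(ℝ, E) γ' t ((1 : ℝ →L[ℝ] ℝ).smulRight v') := by
  subst hv
  exact h.congr_of_eventuallyEq hγ

theorem HasMFDerivAt.comp_hasDerivAt_real {γ : ℝ → G} {σ : ℝ → ℝ} {t c : ℝ} {v : E}
    (h : HasMFDerivAt 𝓘(ℝ, ℝ) 𝓘(ℝ, E) γ (σ t) ((1 : ℝ →L[ℝ] ℝ).smulRight v))
    (hσ : HasDerivAt σ c t) :
    HasMFDerivAt 𝓘(ℝ, ℝ) 𝓘(ℝ, E) (fun s => γ (σ s)) t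
      ((1 : ℝ →L[ℝ] ℝ).smulRight (c • v)) := by
  have h1 : HasFDerivAt σ ((1 : ℝ →L[ℝ] ℝ).smulRight c) t := by
    have : (1 : ℝ →L[ℝ] ℝ).smulRight c = ContinuousLinearMap.toSpanSingleton ℝ c := by ext; simp
    rw [this]
    exact hσ.hasFDerivAt
  have h2 : HasMFDerivAt 𝓘(ℝ, ℝ) 𝓘(ℝ, ℝ) σ t ((1 : ℝ →L[ℝ] ℝ).smulRight c) :=
    hasMFDerivAt_iff_hasFDerivAt.2 h1
  have h3 : ∀ v : E, ((1 : ℝ →L[ℝ] ℝ).smulRight v).comp ((1 : ℝ →L[ℝ] ℝ).smulRight c) =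
      (1 : ℝ →L[ℝ] ℝ).smulRight (c • v) := fun v => by ext; simp
  exact h3 v ▸ h.comp t h2

theorem quasiMeasurePreserving_two_mul_sub_one :
    Measure.QuasiMeasurePreserving (fun t : ℝ => 2 * t - 1)
      (volume.restrict (Icc (1 / 2) 1)) (volume.restrict (Icc 0 1)) := by
  have h : Measure.QuasiMeasurePreserving (fun t : ℝ => 2 * t - 1) volume volume := by
    have h1 : Measure.QuasiMeasurePreserving (fun t : ℝ => 2 * t) volume volume :=
      ⟨by fun_prop, by
        rw [Real.map_volume_mul_left (by norm_num)]
        exact Measure.smul_absolutelyContinuous⟩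
    exact (measurePreserving_sub_right volume (1 : ℝ)).quasiMeasurePreserving.comp h1
  refine h.restrict fun t ht => ?_
  constructor <;> linarith [ht.1, ht.2]

theorem lintegral_two_mul_sub_one (f : ℝ → ℝ≥0∞) :
    ∫⁻ t in Icc (1 / 2 : ℝ) 1, 2 * f (2 * t - 1) = ∫⁻ t in Icc (0 : ℝ) 1, f t := by
  have himg : (fun t : ℝ => 2 * t - 1) '' Icc (1 / 2) 1 = Icc 0 1 := by
    ext x
    constructor
    · rintro ⟨t, ht, rfl⟩
      constructor <;> linarith [ht.1, ht.2]
    · intro hx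
      exact ⟨(x + 1) / 2, ⟨by linarith [hx.1], by linarith [hx.2]⟩, by ring⟩
  rw [← himg, lintegral_image_eq_lintegral_abs_deriv_mul (f' := fun _ => 2) measurableSet_Icc]
  · simp
  · intro t _
    simpa using (((hasDerivAt_id t).const_mul 2).sub_const 1).hasDerivWithinAt
  · intro x _ y _ hxy
    simpa using hxy

variable [Group G] [LieGroup 𝓘(ℝ, E) ∞ G] {m : ℕ} {X : Fin m → GroupLieAlgebra 𝓘(ℝ, E) G}

/-- A horizontal curve can be prolonged by a `C¹` integral curve of a multiple of one of the
vector fields. -/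
theorem IsHorizontalCurve.prepend {γ : ℝ → G} {a : ℝ → EuclideanSpace ℝ (Fin m)}
    (hγ : IsHorizontalCurve X γ a) {ψ : ℝ → G} {J : Set ℝ} (hJs : Icc 0 (1 / 2) ⊆ J)
    (hψ : ContMDiffOn 𝓘(ℝ, ℝ) 𝓘(ℝ, E) 1 ψ J) (j : Fin m) {c : ℝ}
    (hd : ∀ t ∈ J, HasMFDerivAt 𝓘(ℝ, ℝ) 𝓘(ℝ, E) ψ t
      ((1 : ℝ →L[ℝ] ℝ).smulRight (c • rightInvariantVectorField (X j) (ψ t))))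
    (hψγ : ψ (1 / 2) = γ 0) :
    IsHorizontalCurve X (fun t => if t ≤ 1 / 2 then ψ t else γ (2 * t - 1))
      (fun t => if t ≤ 1 / 2 then EuclideanSpace.single j c else (2 : ℝ) • a (2 * t - 1)) := by
  have hman : IsManifold 𝓘(ℝ, E) 1 G := IsManifold.of_le (n := ∞) ENat.LEInfty.out
  have e1 : EqOn (fun t => if t ≤ 1 / 2 then ψ t else γ (2 * t - 1)) ψ (Iic (1 / 2)) :=
    fun t ht => if_pos ht
  have e2 : EqOn (fun t => if t ≤ 1 / 2 then ψ t else γ (2 * t - 1)) (fun t => γ (2 * t - 1))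
      (Ici (1 / 2)) := by
    intro t ht
    rcases (show 1 / 2 ≤ t from ht).eq_or_lt with h | h
    · subst h; simp only [le_refl, if_true, hψγ]; norm_num
    · exact if_neg (not_le.2 h)
  set Γ : ℝ → G := fun t => if t ≤ 1 / 2 then ψ t else γ (2 * t - 1) with hΓ
  constructor
  · rw [show Icc (0 : ℝ) 1 = Icc 0 (1 / 2) ∪ Icc (1 / 2) 1 from
      (Icc_union_Icc_eq_Icc (by norm_num) (by norm_num)).symm]
    refine ContinuousOn.union_of_isClosed ?_ ?_ isClosed_Icc isClosed_Icc
    · exact (hψ.continuousOn.mono hJs).congr (e1.mono fun t ht => ht.2)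
    · refine ContinuousOn.congr ?_ (e2.mono fun t ht => ht.1)
      refine hγ.continuousOn.comp (by fun_prop) fun t ht => ?_
      constructor <;> linarith [ht.1, ht.2]
  · intro x u v hu huv hv hsrc
    have A : ∀ u v, 0 ≤ u → u ≤ v → v ≤ 1 / 2 → (∀ t ∈ Icc u v, Γ t ∈ (chartAt E x).source) →
        AbsolutelyContinuousOnInterval (fun t => chartAt E x (Γ t)) u v := by
      intro u v hu huv hv hsrc
      have hsub : Icc u v ⊆ Iic (1 / 2) := fun t ht => ht.2.trans hv
      have : ContDiffOn ℝ 1 (chartAt E x ∘ ψ) (uIcc u v) := by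
        rw [← contMDiffOn_iff_contDiffOn, uIcc_of_le huv]
        refine (contMDiffOn_chart (I := 𝓘(ℝ, E)) (x := x)).comp
          (hψ.mono fun t ht => hJs ⟨hu.trans ht.1, ht.2.trans hv⟩) fun t ht => ?_
        have := hsrc t ht
        rwa [e1 (hsub ht)] at this
      refine this.absolutelyContinuousOnInterval.congr fun t ht => ?_
      rw [uIcc_of_le huv] at ht
      simp only [Function.comp_apply]
      rw [e1 (hsub ht)]
    have B : ∀ u v, 1 / 2 ≤ u → u ≤ v → v ≤ 1 → (∀ t ∈ Icc u v, Γ t ∈ (chartAt E x).source) →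
        AbsolutelyContinuousOnInterval (fun t => chartAt E x (Γ t)) u v := by
      intro u v hu huv hv hsrc
      have hsub : Icc u v ⊆ Ici (1 / 2) := fun t ht => hu.trans ht.1
      have h1 := hγ.absolutelyContinuous x (2 * u - 1) (2 * v - 1) (by linarith) (by linarith)
        (by linarith) (fun t ht => by
          have h2 : (t + 1) / 2 ∈ Icc u v := ⟨by linarith [ht.1], by linarith [ht.2]⟩
          have := hsrc _ h2
          rw [e2 (hsub h2)] at this
          convert this using 2
          ring)
      have h2 := h1.comp_monotone_lipschitz (φ := fun t => 2 * t - 1) (a := u) (b := v) (K := 2)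
        (fun s t hst => by dsimp only; linarith)
        (LipschitzWith.of_dist_le_mul fun s t => by
          rw [Real.dist_eq, Real.dist_eq, show 2 * s - 1 - (2 * t - 1) = 2 * (s - t) by ring,
            abs_mul]
          simp)
        (fun t ht => by
          rw [uIcc_of_le huv] at ht
          rw [uIcc_of_le (by linarith)]
          constructor <;> linarith [ht.1, ht.2])
      refine h2.congr fun t ht => ?_
      rw [uIcc_of_le huv] at ht
      simp only [Function.comp_apply]
      rw [e2 (hsub ht)]
    rcases le_total v (1 / 2) with h | h
    · exact A u v hu huv h hsrc
    rcases le_total (1 / 2) u with h' | h'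
    · exact B u v h' huv hv hsrc
    exact (A u (1 / 2) hu h' le_rfl fun t ht => hsrc t ⟨ht.1, ht.2.trans h⟩).union h' h
      (B (1 / 2) v le_rfl h hv fun t ht => hsrc t ⟨h'.trans ht.1, ht.2⟩)
  · have h0 := hγ.aestronglyMeasurable.comp_quasiMeasurePreserving
      quasiMeasurePreserving_two_mul_sub_one
    have h1 : AEStronglyMeasurable (fun t => (2 : ℝ) • a (2 * t - 1))
        (volume.restrict (Icc (1 / 2) 1)) := h0.const_smul (2 : ℝ)
    have h2 := AEStronglyMeasurable.piecewise (μ := volume.restrict (Icc (0 : ℝ) 1))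
      (s := Iic (1 / 2)) (f := fun _ : ℝ => EuclideanSpace.single j c)
      (g := fun t => (2 : ℝ) • a (2 * t - 1)) measurableSet_Iic aestronglyMeasurable_const (by
        refine h1.mono_measure ?_
        rw [Measure.restrict_restrict measurableSet_Iic.compl]
        refine Measure.restrict_mono ?_ le_rfl
        rintro t ⟨ht, ht'⟩
        exact ⟨(not_le.1 (show ¬ t ≤ 1 / 2 from ht)).le, ht'.2⟩)
    exact h2
  · have h1 := (ae_restrict_iff' measurableSet_Icc).1
      (quasiMeasurePreserving_two_mul_sub_one.ae hγ.hasMFDerivAt)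
    rw [ae_restrict_iff' measurableSet_Icc]
    -- The glued curve may have a corner at 1/2, a null set.
    have h2 : ∀ᵐ t : ℝ, t ≠ 1 / 2 := by simp [ae_iff, measure_singleton]
    filter_upwards [h1, h2] with t ht hne ht01
    rcases lt_or_gt_of_ne hne with h | h
    · refine (hd t (hJs ⟨ht01.1, h.le⟩)).congr_velocity ?_ ?_
      · filter_upwards [Iic_mem_nhds h] with s hs using e1 hs
      · rw [e1 h.le]
        simp only [if_pos h.le]
        have : ∀ w : Fin m → E, ∑ i, (EuclideanSpace.single j c : EuclideanSpace ℝ (Fin m)) i • w i =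
            c • w j := fun w => by simp
        exact this _
    · refine ((ht ⟨h.le, ht01.2⟩).comp_hasDerivAt_real (σ := fun t => 2 * t - 1) (c := 2)
        (by simpa using ((hasDerivAt_id t).const_mul 2).sub_const 1)).congr_velocity ?_ ?_
      · filter_upwards [Ici_mem_nhds h] with s hs using e2 hs
      · rw [e2 h.le]
        simp only [if_neg (not_le.2 h)]
        have : ∀ (b : EuclideanSpace ℝ (Fin m)) (w : Fin m → E),
            ∑ i, ((2 : ℝ) • b) i • w i = (2 : ℝ) • ∑ i, b i • w i := fun b w => by
          simp [Finset.smul_sum, smul_smul]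
        exact this _ _

omit [LieGroup 𝓘(ℝ, E) ∞ G] in
theorem IsHorizontalCurve.ccEDist_le {γ : ℝ → G} {a : ℝ → EuclideanSpace ℝ (Fin m)}
    (hγ : IsHorizontalCurve X γ a) :
    ccEDist X (γ 0) (γ 1) ≤ ∫⁻ t in Icc (0 : ℝ) 1, ‖a t‖ₑ :=
  iInf_le_of_le γ <| iInf_le_of_le a <| iInf_le_of_le hγ <| iInf_le_of_le rfl <|
    iInf_le_of_le rfl le_rfl

/-- Prepend ψ on [0, 1/2] to an arbitrary competitor from ψ(1/2) to h. The new piece has speed |c|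
for time 1/2, and the competitor, run at double speed, keeps its length. -/
theorem ccEDist_le_of_integralCurve {ψ : ℝ → G} {J : Set ℝ} (hJs : Icc 0 (1 / 2) ⊆ J)
    (hψ : ContMDiffOn 𝓘(ℝ, ℝ) 𝓘(ℝ, E) 1 ψ J) (j : Fin m) {c : ℝ}
    (hd : ∀ t ∈ J, HasMFDerivAt 𝓘(ℝ, ℝ) 𝓘(ℝ, E) ψ t
      ((1 : ℝ →L[ℝ] ℝ).smulRight (c • rightInvariantVectorField (X j) (ψ t)))) (h : G) :
    ccEDist X (ψ 0) h ≤ ccEDist X (ψ (1 / 2)) h + ENNReal.ofReal (|c| / 2) := by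
  conv_rhs => rw [ccEDist]
  simp only [ENNReal.iInf_add]
  refine le_iInf fun γ => le_iInf fun a => le_iInf fun hγ => le_iInf fun h0 => le_iInf fun h1 => ?_
  have key := (hγ.prepend hJs hψ j hd h0.symm).ccEDist_le
  have e0 : (if (0 : ℝ) ≤ 1 / 2 then ψ 0 else γ (2 * 0 - 1)) = ψ 0 := by simp
  have e1 : (if (1 : ℝ) ≤ 1 / 2 then ψ 1 else γ (2 * 1 - 1)) = h := by norm_num [h1]
  simp only [e0, e1] at key
  refine key.trans ?_
  rw [show Icc (0 : ℝ) 1 = Icc 0 (1 / 2) ∪ Icc (1 / 2) 1 from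
    (Icc_union_Icc_eq_Icc (by norm_num) (by norm_num)).symm]
  refine (lintegral_union_le _ _ _).trans ?_
  rw [add_comm]
  refine add_le_add ?_ ?_
  · rw [Icc_union_Icc_eq_Icc (by norm_num) (by norm_num),
      ← lintegral_two_mul_sub_one (fun t => ‖a t‖ₑ), ← restrict_Ioc_eq_restrict_Icc]
    -- The half-open interval omits t = 1/2, where the glued control still takes its first branch.
    have hcongr : ∀ t ∈ Ioc (1 / 2 : ℝ) 1,
        ‖if t ≤ 1 / 2 then EuclideanSpace.single j c else (2 : ℝ) • a (2 * t - 1)‖ₑ =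
          2 * ‖a (2 * t - 1)‖ₑ := fun t ht => by
      rw [if_neg (not_le.2 ht.1), enorm_smul, ← ofReal_norm (2 : ℝ)]
      simp
    exact (setLIntegral_congr_fun measurableSet_Ioc hcongr).le
  · have hcongr : ∀ t ∈ Icc (0 : ℝ) (1 / 2),
        ‖if t ≤ 1 / 2 then EuclideanSpace.single j c else (2 : ℝ) • a (2 * t - 1)‖ₑ =
          ENNReal.ofReal |c| := fun t ht => by
      rw [if_pos ht.2, ← ofReal_norm]
      simp
    rw [setLIntegral_congr_fun measurableSet_Icc hcongr, setLIntegral_const, Real.volume_Icc,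
      ← ENNReal.ofReal_mul (abs_nonneg c)]
    apply ENNReal.ofReal_le_ofReal
    linarith

/-- Moving along the integral curves of the vector fields changes the distance at most by the
elapsed time. -/
theorem ccEDist_mul_le {j : Fin m} {φ : ℝ → G} {η : ℝ}
    (hφ : ∀ t ∈ Ioo (-η) η, HasMFDerivAt 𝓘(ℝ, ℝ) 𝓘(ℝ, E) φ t
        ((1 : ℝ →L[ℝ] ℝ).smulRight (rightInvariantVectorField (X j) (φ t))))
    (hφ' : ContMDiffOn 𝓘(ℝ, ℝ) 𝓘(ℝ, E) 1 φ (Ioo (-η) η)) {s t : ℝ} (hs : s ∈ Ioo (-η) η)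
    (ht : t ∈ Ioo (-η) η) (k h : G) :
    ccEDist X (φ s * k) h ≤ ccEDist X (φ t * k) h + ENNReal.ofReal |t - s| := by
  -- Affine, with σ(0) = s and σ(1/2) = t; its slope 2(t - s) produces the cost |t - s|.
  set σ : ℝ → ℝ := fun x => s + 2 * x * (t - s) with hσ
  have hσd : ∀ x, HasDerivAt σ (2 * (t - s)) x := fun x => by
    simpa [hσ] using (((hasDerivAt_id x).const_mul 2).mul_const (t - s)).const_add s
  have hσc : ContDiff ℝ 1 σ := by fun_prop
  have key := ccEDist_le_of_integralCurve (X := X) (ψ := fun x => φ (σ x) * k)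
    (J := σ ⁻¹' Ioo (-η) η) ?_ ?_ j (c := 2 * (t - s)) ?_ h
  · simp only [hσ] at key
    rw [abs_mul] at key
    norm_num at key
    convert key using 3
  · intro x hx
    have h1 : σ x = (1 - 2 * x) * s + 2 * x * t := by simp only [hσ]; ring
    have : σ x ∈ Ioo (-η) η := by
      rw [h1]
      exact (convex_Ioo (-η) η) hs ht (a := 1 - 2 * x) (b := 2 * x) (by linarith [hx.2])
        (by linarith [hx.1]) (by ring)
    exact this
  · have h1 := hφ'.comp hσc.contMDiff.contMDiffOn (subset_refl (σ ⁻¹' Ioo (-η) η))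
    exact ((contMDiff_mul_right (I := 𝓘(ℝ, E)) (n := ∞) (a := k)).of_le
      ENat.LEInfty.out).comp_contMDiffOn h1
  · intro x hx
    exact ((hφ (σ x) hx).comp_hasDerivAt_real (hσd x)).mul_const_rightInvariant k

end Concatenation

/-! ### Second-order calculus of a group law in a chart -/

section LocalCalculus

open Set Topology Filter

variable {E : Type*} [NormedAddCommGroup E] [NormedSpace ℝ E]

theorem hasFDerivAt_partial_snd {m : E × E → E} {x y : E} (hm : DifferentiableAt ℝ m (x, y)) :
    HasFDerivAt (fun z => m (x, z)) ((fderiv ℝ m (x, y)).comp (ContinuousLinearMap.inr ℝ E E)) y :=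
  hm.hasFDerivAt.comp y (hasFDerivAt_prodMk_right x y)

theorem hasFDerivAt_partial_fst {m : E × E → E} {x y : E} (hm : DifferentiableAt ℝ m (x, y)) :
    HasFDerivAt (fun z => m (z, y)) ((fderiv ℝ m (x, y)).comp (ContinuousLinearMap.inl ℝ E E)) x :=
  hm.hasFDerivAt.comp x (hasFDerivAt_prodMk_left x y)

theorem ContDiffAt.eventually_differentiableAt {F F' : Type*} [NormedAddCommGroup F]
    [NormedSpace ℝ F] [NormedAddCommGroup F'] [NormedSpace ℝ F'] {f : F → F'} {x : F}
    (hf : ContDiffAt ℝ 2 f x) : ∀ᶠ y in 𝓝 x, DifferentiableAt ℝ f y :=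
  (hf.eventually (by simp)).mono fun _ hy => hy.differentiableAt (by simp)

theorem ContDiffAt.differentiableAt_fderiv {F F' : Type*} [NormedAddCommGroup F]
    [NormedSpace ℝ F] [NormedAddCommGroup F'] [NormedSpace ℝ F'] {f : F → F'} {x : F}
    (hf : ContDiffAt ℝ 2 f x) : DifferentiableAt ℝ (fderiv ℝ f) x :=
  (hf.fderiv_right (m := 1) (by norm_num)).differentiableAt (by simp)

/-- The second partial derivative of a `C²` function, as a function of the first variable. -/
theorem hasFDerivAt_fderiv_partial_snd {m : E × E → E} {x₀ : E}
    (hm : ContDiffAt ℝ 2 m (x₀, x₀)) (w : E) :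
    HasFDerivAt (fun x => fderiv ℝ (fun y => m (x, y)) x₀ w)
      (((fderiv ℝ (fderiv ℝ m) (x₀, x₀)).comp (ContinuousLinearMap.inl ℝ E E)).flip (0, w)) x₀ := by
  have h1 : HasFDerivAt (fun x => fderiv ℝ m (x, x₀))
      ((fderiv ℝ (fderiv ℝ m) (x₀, x₀)).comp (ContinuousLinearMap.inl ℝ E E)) x₀ :=
    hm.differentiableAt_fderiv.hasFDerivAt.comp (f := fun x => (x, x₀)) x₀
      (hasFDerivAt_prodMk_left x₀ x₀)
  have h2 := h1.clm_apply (hasFDerivAt_const ((0 : E), w) x₀)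
  have h3 : ∀ᶠ x in 𝓝 x₀, DifferentiableAt ℝ m (x, x₀) :=
    (Continuous.prodMk_left x₀).continuousAt.eventually hm.eventually_differentiableAt
  refine (h2.congr_of_eventuallyEq ?_).congr_fderiv ?_
  · filter_upwards [h3] with x hx
    rw [(hasFDerivAt_partial_snd hx).fderiv]
    simp
  · ext; simp

/-- If `m` and `c` are a group law and its conjugation, read in a chart, then the derivative of the
adjoint action is the bracket of left-invariant vector fields. -/
theorem hasFDerivAt_fderiv_conj {m c : E × E → E} {x₀ : E}
    (hm : ContDiffAt ℝ 2 m (x₀, x₀)) (hc : ContDiffAt ℝ 2 c (x₀, x₀))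
    (hm1 : ∀ᶠ x in 𝓝 x₀, m (x, x₀) = x) (hm2 : ∀ᶠ y in 𝓝 x₀, m (x₀, y) = y)
    (hc1 : ∀ᶠ x in 𝓝 x₀, c (x, x₀) = x₀) (hcm : ∀ᶠ p in 𝓝 (x₀, x₀), m (c p, p.1) = m p)
    (w : E) : ∃ A : E →L[ℝ] E, HasFDerivAt (fun x => fderiv ℝ (fun y => c (x, y)) x₀ w) A x₀ ∧
      ∀ v, A v = VectorField.lieBracket ℝ (fun x => fderiv ℝ (fun y => m (x, y)) x₀ v)
        (fun x => fderiv ℝ (fun y => m (x, y)) x₀ w) x₀ := by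
  set B := fderiv ℝ (fderiv ℝ m) (x₀, x₀) with hB
  have hA := hasFDerivAt_fderiv_partial_snd hc w
  set A := ((fderiv ℝ (fderiv ℝ c) (x₀, x₀)).comp (ContinuousLinearMap.inl ℝ E E)).flip (0, w)
  refine ⟨A, hA, fun v => ?_⟩
  have hmd := hm.eventually_differentiableAt
  have hcd := hc.eventually_differentiableAt
  have cont1 : Tendsto (fun x => (x, x₀)) (𝓝 x₀) (𝓝 (x₀, x₀)) :=
    (Continuous.prodMk_left x₀).continuousAt
  have cont2 : Tendsto (fun x => (x₀, x)) (𝓝 x₀) (𝓝 (x₀, x₀)) :=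
    (Continuous.prodMk_right x₀).continuousAt
  have hid1 : ∀ u, fderiv ℝ m (x₀, x₀) (u, 0) = u := fun u => by
    have h1 := hasFDerivAt_partial_fst hmd.self_of_nhds
    have h2 := (hasFDerivAt_id (𝕜 := ℝ) x₀).congr_of_eventuallyEq (f₁ := fun z => m (z, x₀)) hm1
    simpa using DFunLike.congr_fun (h1.unique h2) u
  have hid2 : ∀ u, fderiv ℝ m (x₀, x₀) (0, u) = u := fun u => by
    have h1 := hasFDerivAt_partial_snd hmd.self_of_nhds
    have h2 := (hasFDerivAt_id (𝕜 := ℝ) x₀).congr_of_eventuallyEq (f₁ := fun z => m (x₀, z)) hm2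
    simpa using DFunLike.congr_fun (h1.unique h2) u
  have hc2 : ∀ᶠ y in 𝓝 x₀, c (x₀, y) = y := by
    have h1 : Tendsto (fun y => c (x₀, y)) (𝓝 x₀) (𝓝 x₀) := by
      have := hc.continuousAt.tendsto.comp cont2
      rwa [hc1.self_of_nhds] at this
    filter_upwards [h1.eventually hm1, cont2.eventually hcm, hm2] with y h2 h3 h4
    rw [← h2, h3, h4]
  have hAw : fderiv ℝ (fun y => c (x₀, y)) x₀ w = w := by
    rw [((hasFDerivAt_id (𝕜 := ℝ) x₀).congr_of_eventuallyEq (f₁ := fun z => c (x₀, z)) hc2).fderiv]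
    simp
  -- Differentiating (x y x⁻¹) x = x y in y: the right translate of Ad(x)w to x is the
  -- left-invariant field of w at x.
  have key : ∀ᶠ x in 𝓝 x₀, fderiv ℝ m (x₀, x) (fderiv ℝ (fun y => c (x, y)) x₀ w, 0) =
      fderiv ℝ (fun y => m (x, y)) x₀ w := by
    filter_upwards [hc1, cont1.eventually hcd, cont2.eventually hmd,
      cont1.eventually hcm.eventually_nhds] with x h1 h2 h3 h4
    have h5 := (hasFDerivAt_partial_snd h2).prodMk (hasFDerivAt_const x x₀)
    have h6 : HasFDerivAt m (fderiv ℝ m (x₀, x)) (c (x, x₀), x) := by rw [h1]; exact h3.hasFDerivAt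
    have h7 := h6.comp (f := fun y => (c (x, y), x)) x₀ h5
    have h8 : (fun y => m (x, y)) =ᶠ[𝓝 x₀] m ∘ fun y => (c (x, y), x) := by
      have : Tendsto (fun y => (x, y)) (𝓝 x₀) (𝓝 (x, x₀)) :=
        (Continuous.prodMk_right x).continuousAt
      filter_upwards [this.eventually h4] with y hy using hy.symm
    rw [(h7.congr_of_eventuallyEq h8).fderiv, (hasFDerivAt_partial_snd h2).fderiv]
    simp
  have hL : HasFDerivAt (fun x => fderiv ℝ m (x₀, x))
      (B.comp (ContinuousLinearMap.inr ℝ E E)) x₀ :=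
    hm.differentiableAt_fderiv.hasFDerivAt.comp x₀ (hasFDerivAt_prodMk_right x₀ x₀)
  have hΦ := hL.clm_apply (hA.prodMk (hasFDerivAt_const (0 : E) x₀))
  have hΨ := (hasFDerivAt_fderiv_partial_snd hm w).congr_of_eventuallyEq key
  -- Differentiating `key` in x along v gives B(0,v)(w,0) + A v = B(v,0)(0,w). Symmetry of B turns A
  -- v into the coordinate formula for the bracket.
  have h := DFunLike.congr_fun (hΦ.unique hΨ) v
  have hsymm : B (0, v) (w, 0) = B (w, 0) (0, v) :=
    hm.isSymmSndFDerivAt (by simp) (0, v) (w, 0)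
  have hv := (hasFDerivAt_fderiv_partial_snd hm v).fderiv
  have hw := (hasFDerivAt_fderiv_partial_snd hm w).fderiv
  simp only [VectorField.lieBracket, hv, hw, (hasFDerivAt_partial_snd hmd.self_of_nhds).fderiv,
    ← hB]
  simp [hid1, hid2, hAw, hsymm] at h ⊢
  rw [← h]
  abel

end LocalCalculus

/-! ### The adjoint representation and its derivative -/

section Adjoint

open Set Topology Filter VectorField

variable {E : Type*} [NormedAddCommGroup E] [NormedSpace ℝ E]
  {G : Type*} [TopologicalSpace G] [ChartedSpace E G] [Group G]

variable (E G) in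
/-- The preferred chart at the identity. -/
noncomputable abbrev oneChart : PartialEquiv G E := extChartAt 𝓘(ℝ, E) (1 : G)

theorem oneChart_symm_one : (oneChart E G).symm (oneChart E G 1) = 1 := extChartAt_to_inv _

theorem eventually_mem_oneChart_source : ∀ᶠ g in 𝓝 (1 : G), g ∈ (oneChart E G).source :=
  extChartAt_source_mem_nhds _

theorem eventually_mem_oneChart_target :
    ∀ᶠ y in 𝓝 (oneChart E G 1), y ∈ (oneChart E G).target :=
  extChartAt_target_mem_nhds _

variable [LieGroup 𝓘(ℝ, E) ∞ G]

theorem contMDiffAt_oneChart_symm {y : E} (hy : y ∈ (oneChart E G).target) :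
    ContMDiffAt 𝓘(ℝ, E) 𝓘(ℝ, E) ∞ (oneChart E G).symm y :=
  (contMDiffOn_extChartAt_symm (1 : G)).contMDiffAt
    ((isOpen_extChartAt_target (1 : G)).mem_nhds hy)

theorem contDiffAt_oneChart_comp {F : Type*} [NormedAddCommGroup F] [NormedSpace ℝ F] {f : F → G}
    {p : F} (hf : ContMDiffAt 𝓘(ℝ, F) 𝓘(ℝ, E) ∞ f p) (hp : f p ∈ (oneChart E G).source) :
    ContDiffAt ℝ ∞ (fun x => oneChart E G (f x)) p := by
  rw [← contMDiffAt_iff_contDiffAt]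
  rw [extChartAt_source] at hp
  exact (contMDiffAt_extChartAt' hp).comp p hf

theorem contMDiffAt_oneChart_symm_comp {F : Type*} [NormedAddCommGroup F] [NormedSpace ℝ F]
    {f : F → E} {p : F} (hf : ContDiffAt ℝ ∞ f p) (hp : f p = oneChart E G 1) :
    ContMDiffAt 𝓘(ℝ, F) 𝓘(ℝ, E) ∞ (fun x => (oneChart E G).symm (f x)) p :=
  (contMDiffAt_oneChart_symm (hp ▸ mem_extChartAt_target (1 : G))).comp p hf.contMDiffAt

theorem contDiffAt_oneChart_conj (g : G) :
    ContDiffAt ℝ ∞ (fun y => oneChart E G (g * (oneChart E G).symm y * g⁻¹)) (oneChart E G 1) := by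
  refine contDiffAt_oneChart_comp ?_ (by simp)
  exact (contMDiffAt_const.mul (contMDiffAt_oneChart_symm_comp contDiffAt_id rfl)).mul
    contMDiffAt_const

/-- The adjoint representation of a Lie group, on the model space. -/
noncomputable def adjointRep (g : G) : E →L[ℝ] E :=
  fderiv ℝ (fun y => oneChart E G (g * (oneChart E G).symm y * g⁻¹)) (oneChart E G 1)

omit [LieGroup 𝓘(ℝ, E) ∞ G] in
theorem adjointRep_one : adjointRep (1 : G) = ContinuousLinearMap.id ℝ E := by
  have : (fun y => oneChart E G (1 * (oneChart E G).symm y * 1⁻¹)) =ᶠ[𝓝 (oneChart E G 1)] id := by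
    filter_upwards [eventually_mem_oneChart_target] with y hy
    simp only [one_mul, inv_one, mul_one, id]
    exact (oneChart E G).right_inv hy
  rw [adjointRep, this.fderiv_eq, fderiv_id]

theorem adjointRep_mul (g h : G) :
    adjointRep (g * h) = (adjointRep g : E →L[ℝ] E).comp (adjointRep h) := by
  set e := oneChart E G
  have hh := (contDiffAt_oneChart_conj (E := E) h).differentiableAt (by simp)
  have hh1 : e (h * e.symm (e 1) * h⁻¹) = e 1 := by rw [oneChart_symm_one]; simp
  have hg : DifferentiableAt ℝ (fun y => e (g * e.symm y * g⁻¹)) (e (h * e.symm (e 1) * h⁻¹)) := by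
    rw [hh1]
    exact (contDiffAt_oneChart_conj (E := E) g).differentiableAt (by simp)
  have hcomp := fderiv_comp (e 1) hg hh
  have hsrc : ∀ᶠ y in 𝓝 (e 1), h * e.symm y * h⁻¹ ∈ e.source := by
    have hcont : ContinuousAt (fun y => h * e.symm y * h⁻¹) (e 1) :=
      ((contMDiffAt_const.mul (contMDiffAt_oneChart_symm_comp (E := E) (G := G)
        contDiffAt_id rfl)).mul contMDiffAt_const).continuousAt
    have := hcont.tendsto
    rw [oneChart_symm_one, mul_one, mul_inv_cancel] at this
    exact this.eventually eventually_mem_oneChart_source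
  have heq : (fun y => e (g * h * e.symm y * (g * h)⁻¹)) =ᶠ[𝓝 (e 1)]
      (fun y => e (g * e.symm y * g⁻¹)) ∘ fun y => e (h * e.symm y * h⁻¹) := by
    filter_upwards [hsrc] with y hy
    simp only [Function.comp_apply]
    rw [e.left_inv hy]
    group
  rw [adjointRep, heq.fderiv_eq, hcomp, hh1]
  rfl

/-- A left-invariant vector field, read in the chart at the identity. -/
theorem mpullbackWithin_mulInvariantVectorField (v : GroupLieAlgebra 𝓘(ℝ, E) G) :
    mpullbackWithin 𝓘(ℝ, E) 𝓘(ℝ, E) (oneChart E G).symm (mulInvariantVectorField v)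
      (range 𝓘(ℝ, E)) =ᶠ[𝓝 (oneChart E G 1)]
    fun x => fderiv ℝ (fun y => oneChart E G ((oneChart E G).symm x * (oneChart E G).symm y))
      (oneChart E G 1) v := by
  have : IsManifold 𝓘(ℝ, E) 1 G := IsManifold.of_le (n := ∞) ENat.LEInfty.out
  filter_upwards [eventually_mem_oneChart_target] with x hx
  set e := oneChart E G
  set g := e.symm x with hg
  have hgs : g ∈ e.source := e.map_target hx
  have hinv : (mfderivWithin 𝓘(ℝ, E) 𝓘(ℝ, E) e.symm (range 𝓘(ℝ, E)) x).inverse =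
      mfderiv 𝓘(ℝ, E) 𝓘(ℝ, E) e g :=
    ContinuousLinearMap.inverse_eq
      (mfderivWithin_extChartAt_symm_comp_mfderiv_extChartAt hx)
      (mfderiv_extChartAt_comp_mfderivWithin_extChartAt_symm hx)
  rw [mpullbackWithin_apply, hinv]
  have d1 : MDifferentiableAt 𝓘(ℝ, E) 𝓘(ℝ, E) e.symm (e 1) :=
    (contMDiffAt_oneChart_symm (mem_extChartAt_target (1 : G))).mdifferentiableAt (by simp)
  have hone : e.symm (e 1) = 1 := oneChart_symm_one
  have d2 : MDifferentiableAt 𝓘(ℝ, E) 𝓘(ℝ, E) (fun h : G => g * h) (1 : G) :=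
    (contMDiff_mul_left (I := 𝓘(ℝ, E)) (n := ∞) (a := g)).mdifferentiableAt (by simp)
  have d3 : MDifferentiableAt 𝓘(ℝ, E) 𝓘(ℝ, E) e g :=
    mdifferentiableAt_extChartAt (by rwa [extChartAt_source] at hgs)
  have hsymm : mfderiv 𝓘(ℝ, E) 𝓘(ℝ, E) e.symm (e 1) = ContinuousLinearMap.id ℝ E := by
    have := mfderivWithin_range_extChartAt_symm (I := 𝓘(ℝ, E)) (x := (1 : G))
    rwa [ModelWithCorners.range_eq_univ, mfderivWithin_univ] at this
  have h2 : HasMFDerivAt 𝓘(ℝ, E) 𝓘(ℝ, E) (fun h : G => g * h) (e.symm (e 1))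
      (mfderiv 𝓘(ℝ, E) 𝓘(ℝ, E) (fun h : G => g * h) 1 : E →L[ℝ] E) := by
    rw [hone]
    exact d2.hasMFDerivAt
  have h3 : HasMFDerivAt 𝓘(ℝ, E) 𝓘(ℝ, E) e (g * e.symm (e 1))
      (mfderiv 𝓘(ℝ, E) 𝓘(ℝ, E) e g : E →L[ℝ] E) := by
    rw [hone, mul_one]
    exact d3.hasMFDerivAt
  have h123 := ((h3.comp _ h2).comp _ d1.hasMFDerivAt).hasFDerivAt
  rw [hsymm] at h123
  have key : ∀ (f : E → E) (L₁ L₂ : E →L[ℝ] E) (u : E),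
      HasFDerivAt f ((L₁.comp L₂).comp (ContinuousLinearMap.id ℝ E)) (e 1) →
        fderiv ℝ f (e 1) u = L₁ (L₂ u) := fun f L₁ L₂ u h => by rw [h.fderiv]; rfl
  exact (key _ _ _ v h123).symm

/-- The manifold bracket is computed by pulling back to the chart at 1, whose differential there is
the identity. This brings the bracket into the form delivered by `hasFDerivAt_fderiv_conj`. -/
theorem GroupLieAlgebra.bracket_eq_lieBracket (v w : GroupLieAlgebra 𝓘(ℝ, E) G) :
    ⁅v, w⁆ = lieBracket ℝ
      (fun x => fderiv ℝ (fun y => oneChart E G ((oneChart E G).symm x * (oneChart E G).symm y))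
        (oneChart E G 1) v)
      (fun x => fderiv ℝ (fun y => oneChart E G ((oneChart E G).symm x * (oneChart E G).symm y))
        (oneChart E G 1) w) (oneChart E G 1) := by
  have : IsManifold 𝓘(ℝ, E) 1 G := IsManifold.of_le (n := ∞) ENat.LEInfty.out
  rw [GroupLieAlgebra.bracket_def, mlieBracket, mlieBracketWithin_apply, mfderiv_extChartAt_self,
    preimage_univ, univ_inter]
  have hinv : ∀ u : E, (ContinuousLinearMap.id ℝ E).inverse u = u := by simp
  refine (hinv _).trans ?_
  have h := (mpullbackWithin_mulInvariantVectorField v).lieBracket_vectorField_eq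
    (mpullbackWithin_mulInvariantVectorField w) (𝕜 := ℝ)
  refine Eq.trans ?_ h
  rw [ModelWithCorners.range_eq_univ]
  exact congrFun lieBracketWithin_univ _

/-- The derivative of the adjoint representation is the Lie bracket. -/
theorem hasDerivAt_adjointRep {φ : ℝ → G} (h0 : φ 0 = 1) {v : GroupLieAlgebra 𝓘(ℝ, E) G}
    (hφ : HasMFDerivAt 𝓘(ℝ, ℝ) 𝓘(ℝ, E) φ 0 ((1 : ℝ →L[ℝ] ℝ).smulRight (v : E)))
    (w : GroupLieAlgebra 𝓘(ℝ, E) G) :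
    HasDerivAt (F := E) (fun s => (adjointRep (φ s) : E →L[ℝ] E) w)
      (⁅v, w⁆ : GroupLieAlgebra 𝓘(ℝ, E) G) 0 := by
  have : IsManifold 𝓘(ℝ, E) 1 G := IsManifold.of_le (n := ∞) ENat.LEInfty.out
  set e := oneChart E G
  have hone : e.symm (e 1) = 1 := oneChart_symm_one
  have c1 : ContMDiffAt 𝓘(ℝ, E × E) 𝓘(ℝ, E) ∞ (fun p : E × E => e.symm p.1) (e 1, e 1) :=
    contMDiffAt_oneChart_symm_comp contDiffAt_fst rfl
  have c2 : ContMDiffAt 𝓘(ℝ, E × E) 𝓘(ℝ, E) ∞ (fun p : E × E => e.symm p.2) (e 1, e 1) :=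
    contMDiffAt_oneChart_symm_comp contDiffAt_snd rfl
  have hc1 : ContinuousAt (fun p : E × E => e.symm p.1) (e 1, e 1) := c1.continuousAt
  have hcc := (c1.mul c2).mul c1.inv
  have hm : ContDiffAt ℝ ∞ (fun p : E × E => e (e.symm p.1 * e.symm p.2)) (e 1, e 1) :=
    contDiffAt_oneChart_comp (c1.mul c2) (by simp [e])
  have hc : ContDiffAt ℝ ∞ (fun p : E × E => e (e.symm p.1 * e.symm p.2 * (e.symm p.1)⁻¹))
      (e 1, e 1) :=
    contDiffAt_oneChart_comp hcc (by simp [e])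
  have hm1 : ∀ᶠ x in 𝓝 (e 1), e (e.symm x * e.symm (e 1)) = x := by
    filter_upwards [eventually_mem_oneChart_target] with x hx
    simp only [hone, mul_one]
    exact e.right_inv hx
  have hm2 : ∀ᶠ y in 𝓝 (e 1), e (e.symm (e 1) * e.symm y) = y := by
    filter_upwards [eventually_mem_oneChart_target] with x hx
    simp only [hone, one_mul]
    exact e.right_inv hx
  have hcm : ∀ᶠ p in 𝓝 (e 1, e 1),
      e (e.symm (e (e.symm p.1 * e.symm p.2 * (e.symm p.1)⁻¹)) * e.symm p.1) =
        e (e.symm p.1 * e.symm p.2) := by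
    have ht : Tendsto (fun p : E × E => e.symm p.1 * e.symm p.2 * (e.symm p.1)⁻¹) (𝓝 (e 1, e 1))
        (𝓝 1) := by
      have := hcc.continuousAt.tendsto
      simp only [Pi.mul_apply, hone, mul_one, inv_one] at this
      exact this
    filter_upwards [ht.eventually (eventually_mem_oneChart_source (E := E))] with p hp
    rw [e.left_inv hp]
    simp
  obtain ⟨A, hA, hAv⟩ := hasFDerivAt_fderiv_conj (hm.of_le ENat.LEInfty.out)
    (hc.of_le ENat.LEInfty.out) hm1 hm2 (Eventually.of_forall fun x => by simp [hone]) hcm (w : E)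
  have hev : ∀ᶠ s in 𝓝 (0 : ℝ), φ s ∈ e.source :=
    hφ.continuousAt.eventually_mem (by rw [h0]; exact eventually_mem_oneChart_source)
  have he : HasDerivAt (e ∘ φ) (v : E) 0 := by
    have h1 := hφ.hasDerivAt_comp (F := e)
      (by rw [h0]; exact mdifferentiableAt_extChartAt (mem_chart_source E 1))
    rw [h0] at h1
    rw [mfderiv_extChartAt_self] at h1
    exact h1
  have hA' : HasFDerivAt (fun x => fderiv ℝ (fun y =>
      e (e.symm x * e.symm y * (e.symm x)⁻¹)) (e 1) (w : E)) A ((e ∘ φ) 0) := by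
    simpa [h0] using hA
  have h2 := hA'.comp_hasDerivAt (0 : ℝ) he
  have h3 : A v = (⁅v, w⁆ : GroupLieAlgebra 𝓘(ℝ, E) G) :=
    (hAv v).trans (GroupLieAlgebra.bracket_eq_lieBracket v w).symm
  rw [← h3]
  refine h2.congr_of_eventuallyEq ?_
  filter_upwards [hev] with s hs
  simp only [Function.comp_apply]
  rw [e.left_inv hs]
  rfl

end Adjoint

/-! ### Generation of a Lie algebra; derivatives in closed subspaces -/

section Algebra

/-- By the Jacobi identity, stability of p under ad x and ad y gives stability under ad [x, y]; the
induction carries this stability along with p itself. -/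
theorem LieSubalgebra.forall_of_lieSpan_eq_top {L : Type*} [LieRing L] [LieAlgebra ℝ L] {s : Set L}
    (hs : LieSubalgebra.lieSpan ℝ L s = ⊤) {p : L → Prop} (h0 : p 0)
    (hadd : ∀ x y, p x → p y → p (x + y)) (hsmul : ∀ (a : ℝ) x, p x → p (a • x))
    (h1 : ∀ x ∈ s, p x) (h2 : ∀ x ∈ s, ∀ w, p w → p ⁅x, w⁆) (x : L) : p x := by
  have key : ∀ x ∈ LieSubalgebra.lieSpan ℝ L s, p x ∧ ∀ w, p w → p ⁅x, w⁆ := by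
    intro x hx
    induction hx using LieSubalgebra.lieSpan_induction with
    | mem x hx => exact ⟨h1 x hx, h2 x hx⟩
    | zero => exact ⟨h0, fun w _ => by simpa using h0⟩
    | add x y _ _ hx hy =>
      refine ⟨hadd _ _ hx.1 hy.1, fun w hw => ?_⟩
      rw [add_lie]
      exact hadd _ _ (hx.2 w hw) (hy.2 w hw)
    | smul a x _ hx =>
      refine ⟨hsmul a _ hx.1, fun w hw => ?_⟩
      rw [smul_lie]
      exact hsmul a _ (hx.2 w hw)
    | lie x y _ _ hx hy =>
      refine ⟨hx.2 y hy.1, fun w hw => ?_⟩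
      rw [lie_lie, sub_eq_add_neg, ← neg_one_smul ℝ]
      exact hadd _ _ (hx.2 _ (hy.2 w hw)) (hsmul _ _ (hy.2 _ (hx.2 w hw)))
  exact (key x (hs ▸ LieSubalgebra.mem_top x)).1

theorem HasDerivAt.mem_of_eventually_mem {E : Type*} [NormedAddCommGroup E] [NormedSpace ℝ E]
    {W : Submodule ℝ E} (hW : IsClosed (W : Set E)) {f : ℝ → E} {f' : E} {t : ℝ}
    (hf : HasDerivAt f f' t) (h : ∀ᶠ s in nhds t, f s ∈ W) : f' ∈ W := by
  refine hW.mem_of_tendsto hf.tendsto_slope ?_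
  filter_upwards [h.filter_mono nhdsWithin_le_nhds] with s hs
  exact W.smul_mem _ (W.sub_mem hs h.self_of_nhds)

end Algebra

/-! ### Small displacements and the span of conjugated generators -/

section Chow

open Set Topology Filter

variable {E : Type*} [NormedAddCommGroup E] [NormedSpace ℝ E]
  {G : Type*} [TopologicalSpace G] [ChartedSpace E G] [Group G]
  {m : ℕ} {X : Fin m → GroupLieAlgebra 𝓘(ℝ, E) G}

/-- The elements `k` such that left translation by `k` and `k⁻¹` increases the distance to the
identity by at most `ε`. -/
def displacementBall (X : Fin m → GroupLieAlgebra 𝓘(ℝ, E) G) (ε : ℝ≥0∞) : Set G :=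
  {k | ∀ g, ccEDist X (k * g) 1 ≤ ccEDist X g 1 + ε ∧ ccEDist X (k⁻¹ * g) 1 ≤ ccEDist X g 1 + ε}

theorem displacementBall_mono {ε ε' : ℝ≥0∞} (h : ε ≤ ε') :
    displacementBall X ε ⊆ displacementBall X ε' := fun _ hk g =>
  ⟨(hk g).1.trans (by gcongr), (hk g).2.trans (by gcongr)⟩

theorem one_mem_displacementBall (ε : ℝ≥0∞) : (1 : G) ∈ displacementBall X ε := fun g => by simp

theorem inv_mem_displacementBall {ε : ℝ≥0∞} {k : G} (hk : k ∈ displacementBall X ε) :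
    k⁻¹ ∈ displacementBall X ε := fun g => ⟨(hk g).2, by simpa using (hk g).1⟩

theorem mul_mem_displacementBall {ε ε' : ℝ≥0∞} {k l : G} (hk : k ∈ displacementBall X ε)
    (hl : l ∈ displacementBall X ε') : k * l ∈ displacementBall X (ε + ε') := fun g => by
  constructor
  · rw [mul_assoc]
    calc ccEDist X (k * (l * g)) 1 ≤ ccEDist X (l * g) 1 + ε := (hk _).1
      _ ≤ ccEDist X g 1 + ε' + ε := by gcongr; exact (hl g).1
      _ = _ := by ring
  · rw [mul_inv_rev, mul_assoc]
    calc ccEDist X (l⁻¹ * (k⁻¹ * g)) 1 ≤ ccEDist X (k⁻¹ * g) 1 + ε' := (hl _).2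
      _ ≤ ccEDist X g 1 + ε + ε' := by gcongr; exact (hk g).2
      _ = _ := by ring

theorem rightInvariantVectorField_one (X : GroupLieAlgebra 𝓘(ℝ, E) G) :
    rightInvariantVectorField X (1 : G) = X := by
  unfold rightInvariantVectorField
  have : (fun h : G => h * 1) = id := by ext; simp
  rw [this, mfderiv_id]
  rfl

variable [LieGroup 𝓘(ℝ, E) ∞ G]

/-- The flow line can be travelled from 0 to t or from t to 0 at the same cost, which bounds
translation by φ(t) and by its inverse. -/
theorem mem_displacementBall_of_integralCurve {j : Fin m} {φ : ℝ → G} (h0 : φ 0 = 1) {η : ℝ}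
    (hφ : ∀ t ∈ Ioo (-η) η, HasMFDerivAt 𝓘(ℝ, ℝ) 𝓘(ℝ, E) φ t
        ((1 : ℝ →L[ℝ] ℝ).smulRight (rightInvariantVectorField (X j) (φ t))))
    (hφ' : ContMDiffOn 𝓘(ℝ, ℝ) 𝓘(ℝ, E) 1 φ (Ioo (-η) η)) {t : ℝ} (ht : t ∈ Ioo (-η) η) :
    φ t ∈ displacementBall X (ENNReal.ofReal |t|) := by
  have hη : (0 : ℝ) ∈ Ioo (-η) η := ⟨by linarith [ht.1, ht.2], by linarith [ht.1, ht.2]⟩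
  intro g
  constructor
  · simpa [h0] using ccEDist_mul_le hφ hφ' ht hη g 1
  · simpa [h0] using ccEDist_mul_le hφ hφ' hη ht ((φ t)⁻¹ * g) 1

theorem eventually_mem_displacementBall {j : Fin m} {φ : ℝ → G} (h0 : φ 0 = 1) {η : ℝ} (hη : 0 < η)
    (hφ : ∀ t ∈ Ioo (-η) η, HasMFDerivAt 𝓘(ℝ, ℝ) 𝓘(ℝ, E) φ t
        ((1 : ℝ →L[ℝ] ℝ).smulRight (rightInvariantVectorField (X j) (φ t))))
    (hφ' : ContMDiffOn 𝓘(ℝ, ℝ) 𝓘(ℝ, E) 1 φ (Ioo (-η) η)) {ε : ℝ≥0∞} (hε : 0 < ε) :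
    ∀ᶠ t in 𝓝 (0 : ℝ), φ t ∈ displacementBall X ε := by
  have h1 : Tendsto (fun t : ℝ => ENNReal.ofReal |t|) (𝓝 0) (𝓝 0) := by
    have := (ENNReal.continuous_ofReal.comp continuous_abs).tendsto (0 : ℝ)
    simp only [Function.comp_apply, abs_zero, ENNReal.ofReal_zero] at this
    exact this
  filter_upwards [h1.eventually_lt_const hε, Ioo_mem_nhds (neg_lt_zero.2 hη) hη] with t ht ht'
  exact displacementBall_mono ht.le (mem_displacementBall_of_integralCurve h0 hφ hφ' ht')

/-- The span of the conjugates of the vector fields by group elements of small displacement. -/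
noncomputable def adjointSpan (X : Fin m → GroupLieAlgebra 𝓘(ℝ, E) G) (ε : ℝ≥0∞) : Submodule ℝ E :=
  Submodule.span ℝ {x | ∃ h ∈ displacementBall X ε, ∃ j, x = (adjointRep h : E →L[ℝ] E) (X j)}

omit [LieGroup 𝓘(ℝ, E) ∞ G] in
theorem adjointSpan_mono {ε ε' : ℝ≥0∞} (h : ε ≤ ε') : adjointSpan X ε ≤ adjointSpan X ε' :=
  Submodule.span_mono fun _ ⟨k, hk, hj⟩ => ⟨k, displacementBall_mono h hk, hj⟩

/-- For small s, Ad(φ(s)) maps Ad(h)X_i to Ad(φ(s)h)X_i with displacement at most ε'. So Ad(φ(s))w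
stays in a fixed closed subspace, which therefore contains its derivative [X_j, w]. -/
theorem lie_mem_adjointSpan [FiniteDimensional ℝ E] {ε ε' : ℝ≥0∞} (hε : ε < ε') (j : Fin m) {w : E}
    (hw : w ∈ adjointSpan X ε) :
    (⁅X j, (w : GroupLieAlgebra 𝓘(ℝ, E) G)⁆ : GroupLieAlgebra 𝓘(ℝ, E) G) ∈ adjointSpan X ε' := by
  have : CompleteSpace E := FiniteDimensional.complete ℝ E
  obtain ⟨φ, h0, η, hη, hφ, hφ'⟩ := exists_integralCurve_rightInvariantVectorField (X j)
  have hd : HasMFDerivAt 𝓘(ℝ, ℝ) 𝓘(ℝ, E) φ 0 ((1 : ℝ →L[ℝ] ℝ).smulRight (X j : E)) := by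
    have h1 := hφ 0 ⟨neg_lt_zero.2 hη, hη⟩
    have h2 : (rightInvariantVectorField (X j) (φ 0) : E) = X j := by
      rw [h0, rightInvariantVectorField_one]
    exact h1.congr_velocity (EventuallyEq.refl _ _) h2.symm
  refine (hasDerivAt_adjointRep h0 hd w).mem_of_eventually_mem
    (adjointSpan X ε').closed_of_finiteDimensional ?_
  filter_upwards [eventually_mem_displacementBall h0 hη hφ hφ' (tsub_pos_of_lt hε)] with s hs
  induction hw using Submodule.span_induction with
  | mem x hx =>
    obtain ⟨h, hh, i, rfl⟩ := hx
    refine Submodule.subset_span ⟨φ s * h, ?_, i, ?_⟩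
    · have := mul_mem_displacementBall hs hh
      rwa [tsub_add_cancel_of_le hε.le] at this
    · rw [adjointRep_mul]
      rfl
  | zero => rw [map_zero]; exact Submodule.zero_mem _
  | add x y _ _ hx hy => rw [map_add]; exact Submodule.add_mem _ hx hy
  | smul a x _ hx => rw [map_smul]; exact Submodule.smul_mem _ a hx

/-- The dimension is an integer, monotone in ε, hence constant for small ε. The loss from ε to ε' in
`lie_mem_adjointSpan` then costs nothing, so the span is stable under each ad X_j and contains the
generators. -/
theorem adjointSpan_eq_top [FiniteDimensional ℝ E] (hX : IsHormanderSystem X) {ε : ℝ≥0∞}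
    (hε : 0 < ε) : adjointSpan X ε = ⊤ := by
  have : CompleteSpace E := FiniteDimensional.complete ℝ E
  -- Finiteness of the minimizing ε₀ ensures ε₀ / 2 < ε₀.
  set S : Set ℕ := {n | ∃ ε : ℝ≥0∞, 0 < ε ∧ ε ≠ ⊤ ∧ Module.finrank ℝ (adjointSpan X ε) = n}
  obtain ⟨ε₀, hε₀, hε₀', hmin⟩ : sInf S ∈ S := Nat.sInf_mem ⟨_, 1, by simp, by simp, rfl⟩
  have hstab : ∀ ε', 0 < ε' → ε' ≤ ε₀ → adjointSpan X ε' = adjointSpan X ε₀ := fun ε' h h' =>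
    Submodule.eq_of_le_of_finrank_le (adjointSpan_mono h')
      (hmin ▸ Nat.sInf_le ⟨ε', h, (h'.trans_lt hε₀'.lt_top).ne, rfl⟩)
  have htop : adjointSpan X ε₀ = ⊤ := by
    refine eq_top_iff.2 fun x _ => LieSubalgebra.forall_of_lieSpan_eq_top
      (L := GroupLieAlgebra 𝓘(ℝ, E) G) hX (p := fun x => (x : E) ∈ adjointSpan X ε₀)
      (Submodule.zero_mem _) (fun _ _ => Submodule.add_mem _) (fun a _ => Submodule.smul_mem _ a)
      ?_ ?_ x
    · rintro _ ⟨j, rfl⟩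
      refine Submodule.subset_span ⟨1, one_mem_displacementBall _, j, ?_⟩
      rw [adjointRep_one]
      rfl
    · rintro _ ⟨j, rfl⟩ w hw
      have hlt : ε₀ / 2 < ε₀ := ENNReal.half_lt_self hε₀.ne' hε₀'
      refine lie_mem_adjointSpan hlt j ?_
      rw [hstab _ (ENNReal.half_pos hε₀.ne') hlt.le]
      exact hw
  rcases le_total ε ε₀ with h | h
  · rw [hstab ε hε h, htop]
  · exact eq_top_iff.2 (htop ▸ adjointSpan_mono h)

end Chow

/-! ### Filling a neighbourhood by elements of small displacement -/

section Parametrization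

open Set Topology Filter

variable {E : Type*} [NormedAddCommGroup E] [NormedSpace ℝ E]
  {G : Type*} [TopologicalSpace G] [ChartedSpace E G] [Group G]
  {m : ℕ} {X : Fin m → GroupLieAlgebra 𝓘(ℝ, E) G}

/-- `L` is the differential at the identity of a map, read in the chart at the identity, that takes
values in the elements of displacement at most `ε`. -/
def IsDisplacementDifferential (X : Fin m → GroupLieAlgebra 𝓘(ℝ, E) G) (L : E →L[ℝ] E)
    (ε : ℝ≥0∞) : Prop :=
  ∃ Ψ : E → E, Ψ 0 = oneChart E G 1 ∧ HasStrictFDerivAt Ψ L 0 ∧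
    ∀ᶠ t in 𝓝 (0 : E), (oneChart E G).symm (Ψ t) ∈ displacementBall X ε

theorem isDisplacementDifferential_zero : IsDisplacementDifferential X 0 0 :=
  ⟨fun _ => oneChart E G 1, rfl, hasStrictFDerivAt_const _ _, Eventually.of_forall fun _ => by
    rw [oneChart_symm_one]; exact one_mem_displacementBall _⟩

variable [LieGroup 𝓘(ℝ, E) ∞ G]

/-- Multiply the two maps in G: multiplication has differential (u, v) ↦ u + v at the identity, and
displacements add. -/
theorem IsDisplacementDifferential.add {L L' : E →L[ℝ] E} {ε ε' : ℝ≥0∞}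
    (h : IsDisplacementDifferential X L ε) (h' : IsDisplacementDifferential X L' ε') :
    IsDisplacementDifferential X (L + L') (ε + ε') := by
  obtain ⟨Ψ, h0, hd, hB⟩ := h
  obtain ⟨Ψ', h0', hd', hB'⟩ := h'
  set e := oneChart E G
  have hone : e.symm (e 1) = 1 := oneChart_symm_one
  have c1 : ContMDiffAt 𝓘(ℝ, E × E) 𝓘(ℝ, E) ∞ (fun p : E × E => e.symm p.1) (e 1, e 1) :=
    contMDiffAt_oneChart_symm_comp contDiffAt_fst rfl
  have c2 : ContMDiffAt 𝓘(ℝ, E × E) 𝓘(ℝ, E) ∞ (fun p : E × E => e.symm p.2) (e 1, e 1) :=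
    contMDiffAt_oneChart_symm_comp contDiffAt_snd rfl
  have hm : ContDiffAt ℝ ∞ (fun p : E × E => e (e.symm p.1 * e.symm p.2)) (e 1, e 1) :=
    contDiffAt_oneChart_comp (c1.mul c2) (by simp [e])
  set M := fun p : E × E => e (e.symm p.1 * e.symm p.2) with hM
  have hMd : DifferentiableAt ℝ M (e 1, e 1) := hm.differentiableAt (by simp)
  have hid1 : ∀ u, fderiv ℝ M (e 1, e 1) (u, 0) = u := fun u => by
    have h2 : HasFDerivAt (fun z => M (z, e 1)) (ContinuousLinearMap.id ℝ E) (e 1) := by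
      refine (hasFDerivAt_id (𝕜 := ℝ) (e 1)).congr_of_eventuallyEq ?_
      filter_upwards [eventually_mem_oneChart_target] with x hx
      simp only [hM, hone, mul_one]
      exact e.right_inv hx
    simpa using DFunLike.congr_fun ((hasFDerivAt_partial_fst hMd).unique h2) u
  have hid2 : ∀ u, fderiv ℝ M (e 1, e 1) (0, u) = u := fun u => by
    have h2 : HasFDerivAt (fun z => M (e 1, z)) (ContinuousLinearMap.id ℝ E) (e 1) := by
      refine (hasFDerivAt_id (𝕜 := ℝ) (e 1)).congr_of_eventuallyEq ?_
      filter_upwards [eventually_mem_oneChart_target] with x hx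
      simp only [hM, hone, one_mul]
      exact e.right_inv hx
    simpa using DFunLike.congr_fun ((hasFDerivAt_partial_snd hMd).unique h2) u
  have hMs : HasStrictFDerivAt M (fderiv ℝ M (e 1, e 1)) (Ψ 0, Ψ' 0) := by
    rw [h0, h0']
    exact hm.hasStrictFDerivAt (by simp)
  refine ⟨fun t => M (Ψ t, Ψ' t), ?_, ?_, ?_⟩
  · simp only [hM, h0, h0', hone, mul_one]
    rfl
  · refine (hMs.comp (0 : E) (hd.prodMk hd')).congr_fderiv ?_
    have hid : ∀ u v, fderiv ℝ M (e 1, e 1) (u, v) = u + v := fun u v => by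
      have := (fderiv ℝ M (e 1, e 1)).map_add (u, 0) (0, v)
      rwa [Prod.mk_add_mk, add_zero, zero_add, hid1, hid2] at this
    ext u
    exact hid _ _
  · have hcont : Tendsto (fun t => e.symm (Ψ t) * e.symm (Ψ' t)) (𝓝 0) (𝓝 1) := by
      have h1 : ContinuousAt (fun t => (Ψ t, Ψ' t)) 0 := hd.continuousAt.prodMk hd'.continuousAt
      have h2 : ContinuousAt (fun p : E × E => e.symm p.1 * e.symm p.2) (Ψ 0, Ψ' 0) := by
        rw [h0, h0']
        exact (c1.mul c2).continuousAt
      have h3 := (ContinuousAt.comp (f := fun t => (Ψ t, Ψ' t)) h2 h1).tendsto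
      simpa [Function.comp_def, h0, h0', hone] using h3
    filter_upwards [hB, hB', hcont.eventually (eventually_mem_oneChart_source (E := E))]
      with t ht ht' hts
    rw [hM]
    dsimp only
    rw [e.left_inv hts]
    exact mul_mem_displacementBall ht ht'

theorem IsDisplacementDifferential.sum {ι : Type*} (s : Finset ι) {L : ι → E →L[ℝ] E} {ε : ℝ≥0∞}
    (h : ∀ i ∈ s, IsDisplacementDifferential X (L i) ε) :
    IsDisplacementDifferential X (∑ i ∈ s, L i) (s.card * ε) := by
  classical
  induction s using Finset.induction_on with
  | empty => simpa using isDisplacementDifferential_zero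
  | insert i s hi ih =>
    rw [Finset.sum_insert hi, Finset.card_insert_of_notMem hi]
    have := (h i (Finset.mem_insert_self _ _)).add
      (ih fun j hj => h j (Finset.mem_insert_of_mem hj))
    convert this using 1
    push_cast
    ring

/-- The map is t ↦ h φ(ℓ(t)) h⁻¹, with φ the flow line of X_j^r; each of the three factors
contributes at most ε. -/
theorem isDisplacementDifferential_smulRight [CompleteSpace E] {ε : ℝ≥0∞} (hε : 0 < ε) {h : G}
    (hh : h ∈ displacementBall X ε) (j : Fin m) (ℓ : E →L[ℝ] ℝ) :
    IsDisplacementDifferential X (ℓ.smulRight ((adjointRep h : E →L[ℝ] E) (X j))) (3 * ε) := by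
  have : IsManifold 𝓘(ℝ, E) 1 G := IsManifold.of_le (n := ∞) ENat.LEInfty.out
  obtain ⟨φ, h0, η, hη, hφ, hφ'⟩ := exists_integralCurve_rightInvariantVectorField (X j)
  set e := oneChart E G
  have hone : e.symm (e 1) = 1 := oneChart_symm_one
  have hφC : ContMDiffAt 𝓘(ℝ, ℝ) 𝓘(ℝ, E) 1 φ 0 :=
    hφ'.contMDiffAt (Ioo_mem_nhds (neg_lt_zero.2 hη) hη)
  have hsrc : ∀ᶠ s in 𝓝 (0 : ℝ), φ s ∈ e.source :=
    hφC.continuousAt.eventually_mem (by rw [h0]; exact eventually_mem_oneChart_source)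
  have heφ : HasStrictDerivAt (e ∘ φ) (X j : E) 0 := by
    have h1 : ContDiffAt ℝ 1 (e ∘ φ) 0 := by
      rw [← contMDiffAt_iff_contDiffAt]
      exact (contMDiffAt_extChartAt' (by rw [h0]; exact mem_chart_source E 1)).comp 0 hφC
    refine h1.hasStrictDerivAt' ?_ (by simp)
    have h2 := (hφ 0 ⟨neg_lt_zero.2 hη, hη⟩).hasDerivAt_comp (F := e)
      (by rw [h0]; exact mdifferentiableAt_extChartAt (mem_chart_source E 1))
    rw [h0, mfderiv_extChartAt_self, rightInvariantVectorField_one] at h2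
    exact h2
  have hconj : HasStrictFDerivAt (fun y => e (h * e.symm y * h⁻¹)) (adjointRep h : E →L[ℝ] E)
      ((e ∘ φ) (ℓ 0)) := by
    simp only [map_zero, Function.comp_apply, h0]
    exact (contDiffAt_oneChart_conj h).hasStrictFDerivAt (by simp)
  have heφ' : HasStrictFDerivAt (e ∘ φ) ((1 : ℝ →L[ℝ] ℝ).smulRight (X j : E)) (ℓ 0) := by
    have key : ∀ (f : ℝ → E) (v : E), HasStrictDerivAt f v 0 →
        HasStrictFDerivAt f ((1 : ℝ →L[ℝ] ℝ).smulRight v) 0 := fun f v hf => by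
      refine hf.hasStrictFDerivAt.congr_fderiv ?_
      ext
      simp
    rw [map_zero]
    exact key _ _ heφ
  have hℓ : Tendsto ℓ (𝓝 0) (𝓝 0) := by simpa using ℓ.continuous.tendsto 0
  refine ⟨fun t => e (h * e.symm ((e ∘ φ) (ℓ t)) * h⁻¹), ?_, ?_, ?_⟩
  · simp only [Function.comp_apply, map_zero, h0, hone, mul_one, mul_inv_cancel]
    rfl
  · have hcomp := hconj.comp (0 : E) (heφ'.comp (0 : E) ℓ.hasStrictFDerivAt)
    refine hcomp.congr_fderiv ?_
    have : ∀ (A : E →L[ℝ] E) (v : E), A.comp (((1 : ℝ →L[ℝ] ℝ).smulRight v).comp ℓ) =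
        ℓ.smulRight (A v) := fun A v => by ext; simp
    exact this _ _
  · have hcont : Tendsto (fun s => h * φ s * h⁻¹) (𝓝 0) (𝓝 1) := by
      have := ((contMDiffAt_const (c := h)).mul (hφC.of_le le_rfl)).mul
        (contMDiffAt_const (c := h⁻¹))
      have := this.continuousAt.tendsto
      simp only [Pi.mul_apply, h0, mul_one, mul_inv_cancel] at this
      exact this
    filter_upwards [hℓ.eventually hsrc, hℓ.eventually (eventually_mem_displacementBall h0 hη hφ hφ' hε),
      hℓ.eventually (hcont.eventually (eventually_mem_oneChart_source (E := E)))] with t h1 h2 h3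
    simp only [Function.comp_apply]
    rw [e.left_inv h1, e.left_inv h3]
    have := mul_mem_displacementBall (mul_mem_displacementBall hh h2) (inv_mem_displacementBall hh)
    rwa [show ε + ε + ε = 3 * ε by ring] at this

/-- The quantitative Chow theorem: elements close to the identity have small displacement. -/
theorem displacementBall_mem_nhds_one [FiniteDimensional ℝ E] (hX : IsHormanderSystem X) {ε : ℝ≥0∞}
    (hε : 0 < ε) : displacementBall X ε ∈ 𝓝 (1 : G) := by
  have : CompleteSpace E := FiniteDimensional.complete ℝ E
  set N := Module.finrank ℝ E
  -- One map for each of the N basis vectors, each of displacement at most 3ε'.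
  set ε' : ℝ≥0∞ := ε / (N * 3)
  have hε' : 0 < ε' := ENNReal.div_pos hε.ne'
    (ENNReal.mul_ne_top (ENNReal.natCast_ne_top N) (by simp))
  have hspan := (adjointSpan_eq_top hX hε').ge
  set b := Module.Basis.ofSpan hspan
  have hb : ∀ i, ∃ h ∈ displacementBall X ε', ∃ j, b i = (adjointRep h : E →L[ℝ] E) (X j) :=
    fun i => Module.Basis.ofSpan_subset hspan ⟨i, rfl⟩
  have := FiniteDimensional.fintypeBasisIndex b
  have hP : IsDisplacementDifferential X
      (∑ i, (LinearMap.toContinuousLinearMap (b.coord i)).smulRight (b i)) ε := by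
    have := IsDisplacementDifferential.sum (X := X) Finset.univ (ε := 3 * ε')
      (L := fun i => (LinearMap.toContinuousLinearMap (b.coord i)).smulRight (b i)) fun i _ => by
        obtain ⟨h, hh, j, hj⟩ := hb i
        have := isDisplacementDifferential_smulRight hε' hh j
          (LinearMap.toContinuousLinearMap (b.coord i))
        rwa [← hj] at this
    obtain ⟨Ψ, h0, hd, hB⟩ := this
    refine ⟨Ψ, h0, hd, hB.mono fun t ht => displacementBall_mono ?_ ht⟩
    rw [Finset.card_univ, ← Module.finrank_eq_card_basis b, ← mul_assoc]
    exact ENNReal.mul_div_le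
  -- The dual basis resolves the identity, so the product map has invertible differential and
  -- carries the neighbourhoods of 0 onto those of the chart image of 1.
  have hid : ∑ i, (LinearMap.toContinuousLinearMap (b.coord i)).smulRight (b i) =
      (ContinuousLinearEquiv.refl ℝ E : E →L[ℝ] E) := by
    ext u
    simp
  rw [hid] at hP
  obtain ⟨Ψ, h0, hd, hB⟩ := hP
  have hmap := hd.map_nhds_eq_of_equiv
  have h1 : ∀ᶠ y in 𝓝 (oneChart E G 1), (oneChart E G).symm y ∈ displacementBall X ε := by
    rw [← h0, ← hmap, eventually_map]
    exact hB
  have h2 : Tendsto (oneChart E G) (𝓝 1) (𝓝 (oneChart E G 1)) := continuousAt_extChartAt _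
  filter_upwards [h2.eventually h1, eventually_mem_oneChart_source (E := E)] with g hg hgs
  rwa [(oneChart E G).left_inv hgs] at hg

end Parametrization

/-! ### Finiteness and semicontinuity of the distance to the identity -/

section Distance

open Set Topology Filter MeasureTheory

variable {E : Type*} [NormedAddCommGroup E] [NormedSpace ℝ E]
  {G : Type*} [TopologicalSpace G] [ChartedSpace E G] [Group G]
  {m : ℕ} {X : Fin m → GroupLieAlgebra 𝓘(ℝ, E) G}

theorem ccEDist_one_one : ccEDist X (1 : G) 1 = 0 := by
  have h : IsHorizontalCurve X (fun _ : ℝ => (1 : G)) (fun _ => 0) := by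
    refine ⟨continuousOn_const, fun x u v _ _ _ _ => ?_, aestronglyMeasurable_const,
      Eventually.of_forall fun t => ?_⟩
    · exact (LipschitzWith.const (chartAt E x 1)).lipschitzOnWith.absolutelyContinuousOnInterval
        (K := 0)
    · have h1 := hasMFDerivAt_const (I := 𝓘(ℝ, ℝ)) (I' := 𝓘(ℝ, E)) (1 : G) t
      have h2 : ∀ w : Fin m → E, (1 : ℝ →L[ℝ] ℝ).smulRight
          (∑ j, (0 : EuclideanSpace ℝ (Fin m)) j • w j) = 0 := fun w => by ext; simp
      exact (h2 _).symm ▸ h1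
  have := h.ccEDist_le
  simpa using this

variable [LieGroup 𝓘(ℝ, E) ∞ G]

/-- Chow's theorem: the Carnot–Carathéodory distance of a Hörmander system on a connected group is
finite. -/
theorem ccEDist_one_ne_top [FiniteDimensional ℝ E] [ConnectedSpace G] (hX : IsHormanderSystem X)
    (g : G) : ccEDist X g 1 ≠ ⊤ := by
  have hG : IsTopologicalGroup G := topologicalGroup_of_lieGroup 𝓘(ℝ, E) ∞
  have hmem := displacementBall_mem_nhds_one hX (ε := 1) (by simp)
  have hnhds : ∀ g : G, ∀ᶠ h in 𝓝 g, h * g⁻¹ ∈ displacementBall X 1 := fun g => by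
    have : Tendsto (fun h => h * g⁻¹) (𝓝 g) (𝓝 1) := by
      have : ContinuousAt (fun h => h * g⁻¹) g := by fun_prop
      simpa using this.tendsto
    exact this.eventually hmem
  -- Nearby points differ in distance to the identity by at most 1, so finiteness and infiniteness
  -- are both open conditions.
  have hclopen : IsClopen {g : G | ccEDist X g 1 ≠ ⊤} := by
    constructor
    · rw [← isOpen_compl_iff, isOpen_iff_eventually]
      intro g hg
      filter_upwards [hnhds g] with h hh hfin
      refine hg fun htop => ?_
      have h1 := (hh h).2
      simp only [mul_inv_rev, inv_inv, inv_mul_cancel_right, htop, top_le_iff] at h1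
      exact ENNReal.add_ne_top.2 ⟨hfin, by simp⟩ h1
    · rw [isOpen_iff_eventually]
      intro g hg
      filter_upwards [hnhds g] with h hh
      have h1 := (hh g).1
      rw [inv_mul_cancel_right] at h1
      exact (h1.trans_lt (ENNReal.add_lt_top.2 ⟨hg.lt_top, by simp⟩)).ne
  have huniv := hclopen.eq_univ ⟨1, by simp [ccEDist_one_one]⟩
  exact huniv.ge (mem_univ g)

/-- Writing h = (hg⁻¹)g, the distance exceeds that of g by at most the displacement of hg⁻¹. This
upper semicontinuity suffices for measurability. -/
theorem isOpen_ccEDist_one_lt [FiniteDimensional ℝ E] (hX : IsHormanderSystem X) (r : ℝ≥0∞) :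
    IsOpen {g : G | ccEDist X g 1 < r} := by
  have hG : IsTopologicalGroup G := topologicalGroup_of_lieGroup 𝓘(ℝ, E) ∞
  rw [isOpen_iff_eventually]
  intro g hg
  obtain ⟨c, hc, hcr⟩ := exists_between (show ccEDist X g 1 < r from hg)
  have hmem := displacementBall_mem_nhds_one hX (tsub_pos_of_lt hc)
  have : Tendsto (fun h => h * g⁻¹) (𝓝 g) (𝓝 1) := by
    have : ContinuousAt (fun h => h * g⁻¹) g := by fun_prop
    simpa using this.tendsto
  filter_upwards [this.eventually hmem] with h hh
  have h1 := (hh g).1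
  rw [inv_mul_cancel_right, add_tsub_cancel_of_le hc.le] at h1
  exact h1.trans_lt hcr

end Distance

/-! ### Topology and powers in the semidirect product -/

section SemidirectProduct

open Set Topology
open scoped Pointwise

variable {S K : Type*} [Group S] [Group K] [TopologicalSpace S] [TopologicalSpace K]
  (σ : K →* MulAut S)

/-- A semidirect product of topological groups is homeomorphic to the product. -/
def SemidirectProduct.homeomorphProd : S ⋊[σ] K ≃ₜ S × K :=
  SemidirectProduct.equivProd.toHomeomorphOfIsInducing ⟨rfl⟩

theorem SemidirectProduct.continuous_left : Continuous fun g : S ⋊[σ] K => g.left :=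
  continuous_fst.comp (SemidirectProduct.homeomorphProd σ).continuous

theorem SemidirectProduct.continuous_inl :
    Continuous (SemidirectProduct.inl : S → S ⋊[σ] K) :=
  (SemidirectProduct.homeomorphProd σ).symm.continuous.comp
    (continuous_id.prodMk (continuous_const (y := (1 : K))))

theorem SemidirectProduct.t2Space [T2Space S] [T2Space K] : T2Space (S ⋊[σ] K) :=
  (SemidirectProduct.homeomorphProd σ).symm.t2Space

theorem SemidirectProduct.connectedSpace [ConnectedSpace S] [ConnectedSpace K] :
    ConnectedSpace (S ⋊[σ] K) :=
  (SemidirectProduct.homeomorphProd σ).symm.surjective.connectedSpace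
    (SemidirectProduct.homeomorphProd σ).symm.continuous

/-- A compact group acting continuously by automorphisms leaves invariant some compact
neighbourhood of the identity. -/
theorem exists_isCompact_mem_nhds_one_forall_map_mem [LocallyCompactSpace S] [CompactSpace K]
    (hσ : Continuous fun p : K × S => σ p.1 p.2) :
    ∃ V : Set S, IsCompact V ∧ V ∈ 𝓝 1 ∧ ∀ k, ∀ s ∈ V, σ k s ∈ V := by
  obtain ⟨V, hV, hV1⟩ := exists_compact_mem_nhds (1 : S)
  -- The union of all K-translates of V is compact because K is.
  refine ⟨(fun p : K × S => σ p.1 p.2) '' (univ ×ˢ V), (isCompact_univ.prod hV).image hσ,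
    Filter.mem_of_superset hV1 fun s hs => ⟨(1, s), ⟨mem_univ _, hs⟩, by simp⟩, ?_⟩
  rintro k _ ⟨⟨k', s⟩, ⟨-, hs⟩, rfl⟩
  exact ⟨(k * k', s), ⟨mem_univ _, hs⟩, by simp⟩

omit [TopologicalSpace S] [TopologicalSpace K] in
/-- If `V` is invariant, the left components of the elements of `(V × K) ^ n` lie in `V ^ n`. -/
theorem SemidirectProduct.left_mem_pow {V : Set S} (hV : ∀ k, ∀ s ∈ V, σ k s ∈ V) (n : ℕ)
    {g : S ⋊[σ] K} (hg : g ∈ {g : S ⋊[σ] K | g.left ∈ V} ^ n) : g.left ∈ V ^ n := by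
  have hVn : ∀ n k, ∀ s ∈ V ^ n, σ k s ∈ V ^ n := fun n k s hs => by
    have h1 : (σ k) '' V ⊆ V := image_subset_iff.2 fun s hs => hV k s hs
    have h2 : (σ k) '' (V ^ n) = ((σ k) '' V) ^ n := image_pow (σ k) V n
    exact pow_subset_pow_left h1 (h2 ▸ mem_image_of_mem _ hs)
  induction n generalizing g with
  | zero =>
    rw [pow_zero, mem_one] at hg ⊢
    rw [hg]
    rfl
  | succ n ih =>
    rw [pow_succ] at hg ⊢
    obtain ⟨a, ha, b, hb, rfl⟩ := hg
    -- The left component of ab is a.left · σ(a.right)(b.left), so invariance of V absorbs the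
    -- twist.
    exact mul_mem_mul (ih ha) (hV _ _ hb)

end SemidirectProduct

/-! ### Exponential weights against exponential growth -/

section Integrability

open Set Topology MeasureTheory

/-- A function whose sublevel sets have exponentially growing measure has an integrable exponential
weight. -/
theorem exists_integrable_exp_neg_mul {S : Type*} [MeasurableSpace S] {μ : Measure S} {ρ : S → ℝ}
    (hρ : Measurable ρ) (h0 : ∀ s, 0 ≤ ρ s) {r : ℝ} (hr : 0 < r) {C : ℝ≥0∞} (hC : C ≠ ⊤) (N : ℕ)
    (hμ : ∀ n : ℕ, μ {s | ρ s < (n + 1) * r} ≤ (N : ℝ≥0∞) ^ n * C) :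
    ∃ d : ℝ, 0 < d ∧ Integrable (fun s => Real.exp (-(d * ρ s))) μ := by
  have hlog : 0 < Real.log (2 * N + 2) := Real.log_pos (by
    have : (0 : ℝ) ≤ N := N.cast_nonneg
    linarith)
  -- Then e^(-dr) N = N / (2N + 2) ≤ 1/2; the summand 2 keeps the logarithm positive when N = 0.
  set d := Real.log (2 * N + 2) / r
  have hd : 0 < d := div_pos hlog hr
  refine ⟨d, hd, (by fun_prop : Measurable _).aestronglyMeasurable, ?_⟩
  set q : ℝ≥0∞ := ENNReal.ofReal (Real.exp (-(d * r)))
  have hq : q * N ≤ 2⁻¹ := by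
    have : Real.exp (-(d * r)) * N ≤ 2⁻¹ := by
      have hN : (0 : ℝ) ≤ N := N.cast_nonneg
      rw [show d * r = Real.log (2 * N + 2) from div_mul_cancel₀ _ hr.ne', Real.exp_neg,
        Real.exp_log (by linarith), inv_mul_le_iff₀ (by linarith)]
      linarith
    calc q * N = ENNReal.ofReal (Real.exp (-(d * r)) * N) := by
          rw [ENNReal.ofReal_mul (Real.exp_nonneg _), ENNReal.ofReal_natCast]
      _ ≤ ENNReal.ofReal 2⁻¹ := ENNReal.ofReal_le_ofReal this
      _ = 2⁻¹ := by rw [ENNReal.ofReal_inv_of_pos two_pos, ENNReal.ofReal_ofNat]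
  have hmeas : ∀ n : ℕ, MeasurableSet {s | ρ s < (n + 1) * r} := fun n =>
    measurableSet_lt hρ measurable_const
  have hbound : ∀ s, ‖Real.exp (-(d * ρ s))‖ₑ ≤
      ∑' n : ℕ, {s | ρ s < (n + 1) * r}.indicator (fun _ => q ^ n) s := fun s => by
    -- On the layer nr ≤ ρ < (n + 1)r the integrand is at most q^n, a single term of the series.
    set n := ⌊ρ s / r⌋₊
    have h1 : n * r ≤ ρ s := (le_div_iff₀ hr).1 (Nat.floor_le (div_nonneg (h0 s) hr.le))
    have h2 : ρ s < (n + 1) * r := (div_lt_iff₀ hr).1 (Nat.lt_floor_add_one _)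
    refine le_trans ?_ (ENNReal.le_tsum n)
    rw [indicator_of_mem (show s ∈ {s | ρ s < (n + 1) * r} from h2),
      Real.enorm_of_nonneg (Real.exp_nonneg _), ← ENNReal.ofReal_pow (Real.exp_nonneg _),
      ← Real.exp_nat_mul]
    refine ENNReal.ofReal_le_ofReal (Real.exp_le_exp.2 ?_)
    nlinarith
  calc ∫⁻ s, ‖Real.exp (-(d * ρ s))‖ₑ ∂μ
      ≤ ∫⁻ s, ∑' n : ℕ, {s | ρ s < (n + 1) * r}.indicator (fun _ => q ^ n) s ∂μ :=
        lintegral_mono hbound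
    _ = ∑' n : ℕ, q ^ n * μ {s | ρ s < (n + 1) * r} := by
        rw [lintegral_tsum fun n => (measurable_const.indicator (hmeas n)).aemeasurable]
        exact tsum_congr fun n => lintegral_indicator_const (hmeas n) _
    _ ≤ ∑' n : ℕ, 2⁻¹ ^ n * C := ENNReal.tsum_le_tsum fun n => by
        calc q ^ n * μ {s | ρ s < (n + 1) * r} ≤ q ^ n * ((N : ℝ≥0∞) ^ n * C) := by gcongr; exact hμ n
          _ = (q * N) ^ n * C := by rw [mul_pow, mul_assoc]
          _ ≤ 2⁻¹ ^ n * C := by gcongr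
    _ < ⊤ := by
        rw [ENNReal.tsum_mul_right, ENNReal.tsum_geometric_two]
        exact ENNReal.mul_lt_top (by simp) hC.lt_top

end Integrability

/-! ### Integrability of the inverse weight on S -/

theorem proposition4p2
    -- `K` is a connected compact Lie group
    {EK : Type*} [NormedAddCommGroup EK] [NormedSpace ℝ EK] [FiniteDimensional ℝ EK]
    {K : Type*} [TopologicalSpace K] [ChartedSpace EK K] [Group K] [LieGroup 𝓘(ℝ, EK) ∞ K]
    [T2Space K] [CompactSpace K] [ConnectedSpace K]
    -- `S` is an exponential solvable Lie group
    {ES : Type*} [NormedAddCommGroup ES] [NormedSpace ℝ ES] [FiniteDimensional ℝ ES]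
    {S : Type*} [TopologicalSpace S] [ChartedSpace ES S] [Group S] [LieGroup 𝓘(ℝ, ES) ∞ S]
    (hS : IsExponentialSolvable ES S)
    -- `K` acts continuously on `S` by automorphisms
    (σ : K →* MulAut S) (hσ : Continuous fun p : K × S => σ p.1 p.2)
    -- the Lie group structure of the topological group `G = K ⋉ S`
    {EG : Type*} [NormedAddCommGroup EG] [NormedSpace ℝ EG] [FiniteDimensional ℝ EG]
    [ChartedSpace EG (S ⋊[σ] K)] [LieGroup 𝓘(ℝ, EG) ∞ (S ⋊[σ] K)]
    -- the Hörmander system of the sub-Laplacian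
    {m : ℕ} (X : Fin m → GroupLieAlgebra 𝓘(ℝ, EG) (S ⋊[σ] K)) (hX : IsHormanderSystem X)
    -- a left Haar measure of `S`
    [MeasurableSpace S] [BorelSpace S]
    (μ : MeasureTheory.Measure S) [μ.IsHaarMeasure] :
    ∃ d : ℝ, 0 < d ∧
      MeasureTheory.Integrable
        (fun s : S => 1 / ccWeight X d (SemidirectProduct.inl s : S ⋊[σ] K)) μ := by
  -- The exponential map identifies S topologically with a finite-dimensional vector space:
  -- Hausdorff, connected and locally compact.
  obtain ⟨Φ, -⟩ := hS.exp_diffeo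
  have : T2Space S := Φ.toHomeomorph.t2Space
  have : ConnectedSpace S := Φ.toHomeomorph.surjective.connectedSpace Φ.continuous
  have : ProperSpace ES := FiniteDimensional.proper_real ES
  have : LocallyCompactSpace S := Φ.toHomeomorph.symm.isClosedEmbedding.locallyCompactSpace
  have : IsTopologicalGroup S := topologicalGroup_of_lieGroup 𝓘(ℝ, ES) ∞
  have : T2Space (S ⋊[σ] K) := SemidirectProduct.t2Space σ
  have : ConnectedSpace (S ⋊[σ] K) := SemidirectProduct.connectedSpace σ
  obtain ⟨V, hVc, hV1, hVσ⟩ := exists_isCompact_mem_nhds_one_forall_map_mem σ hσ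
  obtain ⟨N, hN⟩ := exists_measure_pow_le μ hVc hV1
  obtain ⟨r, hr, hball⟩ := exists_ccEDist_lt_imp_mem_pow X
    ((SemidirectProduct.continuous_left σ).continuousAt.preimage_mem_nhds (x := 1) hV1)
  set ρ : S → ℝ := fun s => ccDist X (SemidirectProduct.inl s : S ⋊[σ] K) 1
  have hmeas : Measurable ρ := by
    refine ENNReal.measurable_toReal.comp (measurable_of_Iio fun c => ?_)
    exact ((isOpen_ccEDist_one_lt hX c).preimage
      (SemidirectProduct.continuous_inl σ)).measurableSet
  open scoped Pointwise in
  have hsub : ∀ n : ℕ, {s | ρ s < (n + 1) * r} ⊆ V ^ (n + 1) := fun n s hs => by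
    refine SemidirectProduct.left_mem_pow σ hVσ (n + 1) (hball (n + 1) (SemidirectProduct.inl s) ?_)
    -- Finiteness is essential: `toReal` sends ∞ to 0, so a point at infinite distance would
    -- otherwise enter every sublevel set of ρ.
    rw [ENNReal.lt_ofReal_iff_toReal_lt (ccEDist_one_ne_top hX _)]
    exact_mod_cast hs
  obtain ⟨d, hd, hint⟩ := exists_integrable_exp_neg_mul hmeas (fun _ => ENNReal.toReal_nonneg) hr
    hVc.measure_lt_top.ne N fun n => (MeasureTheory.measure_mono (hsub n)).trans (hN n)
  refine ⟨d, hd, ?_⟩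
  simpa only [ccWeight, one_div, ← Real.exp_neg] using hint
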